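/- Let $m\ge 1$, $L\ge 0$, let $\mathcal B=\{b_1,\dots,b_m\}$ be an alphabet, $[L]=\{1,\dots,L\}$, and let $\Omega=\mathcal B^L$ be the set of words of length $L$. For $b\in\mathcal B$ and $j\in[L]$ let $\partial_{b,j}:\Omega\to\Omega$ be the following map. If $\pi$ contains at least $j$ copies of $b$, then $\partial_{b,j}$ moves the $j$-th copy of $b$ (counted from the left) to the left until it is immediately after the $(j-1)$-st copy (to the front if $j=1$). If $\pi$ contains exactly $j-1$ copies of $b$, then a new $b$ is inserted immediately after the $(j-1)$-st copy (at the front if $j=1$) and the last letter of the word is deleted. If $\pi$ contains fewer than $j-1$ copies of $b$, then $\partial_{b,j}(\pi)=\pi$. The Toom--Tsetlin chain with interlibrary loan applies $\partial_{b,j}$ with probability $x_{b,j}$. Its transition matrix $T_{m,L}$, with rows and columns indexed by $\Omega$, has $(w,v)$-entry $\sum_{(b,j):\,\partial_{b,j}(v)=w}x_{b,j}$. The statement holds for arbitrary real numbers $x_{b,j}$. For $I\subseteq[L]$ put $x_{b,I}=\sum_{s\in I}x_{b,s}$. For a tuple $\vec R=(R_1,\dots,R_m)$ of subsets of $[L]$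 let $e_{\vec R}=\prod_{i=1}^m\prod_{j\in R_i}\partial_{b_i,j}$, a composition of maps acting on the left, where reading from left to right $i$ increases and, for each $i$, $j$ decreases along $R_i$. Write $\vec R\subseteq\vec U$ if $R_i\subseteq U_i$ for all $i$, and $\|\vec R\|_1=\sum_i|R_i|$. Define $$m_{\vec R}=\sum_{\vec R\subseteq\vec U}(-1)^{\|\vec U\|_1-\|\vec R\|_1}\,|e_{\vec U}\Omega| ,$$ the sum being over all tuples $\vec U$ of subsets of $[L]$ with $\vec R\subseteq\vec U$. Then: 1. The characteristic polynomial of $T_{m,L}$ is $$|\lambda\mathbb 1-T_{m,L}|=\Big(\lambda-\sum_{j=1}^m x_{b_j,[L]}\Big)\prod_{I_1,\dots,I_m\subsetneq[L]}\Big(\lambda-\sum_{j=1}^m x_{b_j,I_j}\Big)^{m_{\vec I}},$$ where every $m_{\vec I}$ occurring in the product is a non-negative integer. 2. For every tuple $\vec U$ of subsets of $[L]$, the map $e_{\vec U}$ is idempotent (so its number of fixed points is $|e_{\vec U}\Omega|$), and this number is given as follows. If $U_i\subsetneq[L]$ for all $i$ and $\sum_{i=1}^m\min([L]\setminus U_i)<L+m$,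 then $$|e_{\vec U}\Omega|=\sum_{\vec n\in I(\vec U)}\big(\vec n-\vec f(\vec U,\vec n)\big)! ,$$ and otherwise $|e_{\vec U}\Omega|=1$. Here $\vec v!=\frac{(v_1+\cdots+v_m)!}{v_1!\cdots v_m!}$ if all $v_i\ge0$ and $\vec v!=0$ if some $v_i<0$. The set $I(\vec U)$ consists of all $\vec n\in\mathbb N^m$ with $\sum_i n_i=L$ such that $n_i\ne0$ whenever $1\in U_i$, and such that at most one $i$ satisfies $n_i+1\in U_i$. Finally, $f_i(\vec U,\vec n)=|\{r\in U_i: n_i\ge r-1\}|$. -/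

import Mathlib

namespace ToomTsetlin

/-- Erase the `j`-th copy (counting from `1`, left to right) of the letter `b` from a word;
the word is unchanged if it has no such copy. -/
def eraseCopy {B : Type*} [DecidableEq B] (b : B) : ℕ → List B → List B
  | 0, w => w
  | _ + 1, [] => []
  | j + 1, a :: w =>
    if a = b then (if j = 0 then w else a :: eraseCopy b j w) else a :: eraseCopy b (j + 1) w

/-- Insert a letter `b` immediately after the `i`-th copy of `b` in a word, where `i = 0` means
at the front; the word is unchanged if `i > 0` and it has no `i`-th copy of `b`. -/
def insertAfterCopy {B : Type*} [DecidableEq B] (b : B) : ℕ → List B → List B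
  | 0, w => b :: w
  | _ + 1, [] => []
  | i + 1, a :: w => a :: insertAfterCopy b (if a = b then i else i + 1) w

/-- One step of the Tsetlin library with interlibrary loan, on lists. If the word has at least `j`
copies of `b`, the `j`-th one is moved to the left until it is next to the `(j-1)`-st one (to the
front if `j = 1`). If it has exactly `j - 1` copies, a new copy of `b` is inserted right after the
`(j-1)`-st one (in front if `j = 1`) and the last letter falls off the shelf. Otherwise nothing
happens. -/
def loanList {B : Type*} [DecidableEq B] (b : B) (j : ℕ) (w : List B) : List B :=
  if 1 ≤ j ∧ j ≤ w.count b then insertAfterCopy b (j - 1) (eraseCopy b j w)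
  else if j = w.count b + 1 then (insertAfterCopy b (j - 1) w).dropLast
  else w

theorem length_eraseCopy {B : Type*} [DecidableEq B] (b : B) (w : List B) :
    ∀ j : ℕ, 1 ≤ j → j ≤ w.count b → (eraseCopy b j w).length + 1 = w.length := by
  induction w with
  | nil => intro j h1 h2; simp at h2; omega
  | cons a w ih =>
    intro j h1 h2
    obtain ⟨j, rfl⟩ : ∃ i, j = i + 1 := ⟨j - 1, by omega⟩
    by_cases hab : a = b
    · subst hab
      rw [List.count_cons_self] at h2
      by_cases hj : j = 0
      · simp [eraseCopy, hj]
      · have := ih j (by omega) (by omega)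
        simp [eraseCopy, hj, this]
    · rw [List.count_cons_of_ne hab] at h2
      have := ih (j + 1) h1 h2
      simp [eraseCopy, hab, this]

theorem le_count_eraseCopy {B : Type*} [DecidableEq B] (b : B) (w : List B) :
    ∀ j : ℕ, j ≤ w.count b → j - 1 ≤ (eraseCopy b j w).count b := by
  induction w with
  | nil => intro j h; simp at h; omega
  | cons a w ih =>
    intro j h
    cases j with
    | zero => simp
    | succ j =>
      by_cases hab : a = b
      · subst hab
        rw [List.count_cons_self] at h
        by_cases hj : j = 0
        · simp [hj]
        · have := ih j (by omega)
          simp [eraseCopy, hj]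
          omega
      · rw [List.count_cons_of_ne hab] at h
        have := ih (j + 1) h
        simp [eraseCopy, hab]
        simpa using this

theorem length_insertAfterCopy {B : Type*} [DecidableEq B] (b : B) (w : List B) :
    ∀ i : ℕ, i ≤ w.count b → (insertAfterCopy b i w).length = w.length + 1 := by
  induction w with
  | nil => intro i h; simp at h; simp [h, insertAfterCopy]
  | cons a w ih =>
    intro i h
    cases i with
    | zero => simp [insertAfterCopy]
    | succ i =>
      by_cases hab : a = b
      · subst hab
        rw [List.count_cons_self] at h
        simp [insertAfterCopy, ih i (by omega)]
      · rw [List.count_cons_of_ne hab] at h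
        simp [insertAfterCopy, hab, ih (i + 1) h]

theorem length_loanList {B : Type*} [DecidableEq B] (b : B) (j : ℕ) (w : List B) :
    (loanList b j w).length = w.length := by
  unfold loanList
  split_ifs with h1 h2
  · rw [length_insertAfterCopy _ _ _ (le_count_eraseCopy b w j h1.2)]
    exact length_eraseCopy b w j h1.1 h1.2
  · rw [List.length_dropLast, length_insertAfterCopy _ _ _ (by omega)]
    omega
  · rfl

/-- The states: all words of length `L` over the alphabet `Fin m` of `m` letters. -/
abbrev Word (m L : ℕ) : Type := List.Vector (Fin m) L

/-- The operator `∂_{b,j}` on words of length `L`. -/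
def loan {m L : ℕ} (b : Fin m) (j : ℕ) (w : Word m L) : Word m L :=
  ⟨loanList b j w.1, (length_loanList b j w.1).trans w.2⟩

/-- The transition matrix: in each step `∂_{b,j}` (`1 ≤ j ≤ L`) is applied with weight `x b j`;
the entry in row `w` and column `v` is the weight of the passage from `v` to `w`. -/
noncomputable def transitionMatrix (m L : ℕ) (x : Fin m → ℕ → ℝ) :
    Matrix (Word m L) (Word m L) ℝ :=
  Matrix.of fun w v => ∑ b : Fin m, ∑ j ∈ Finset.Icc 1 L, if loan b j v = w then x b j else 0

/-- All `m`-tuples of subsets of `[L] = {1, …, L}`. -/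
def subsetTuples (m L : ℕ) : Finset (Fin m → Finset ℕ) :=
  Fintype.piFinset fun _ => (Finset.Icc 1 L).powerset

/-- All `m`-tuples of proper subsets of `[L] = {1, …, L}`. -/
def properSubsetTuples (m L : ℕ) : Finset (Fin m → Finset ℕ) :=
  Fintype.piFinset fun _ => (Finset.Icc 1 L).ssubsets

/-- The map `e_R`: the product `∏_i ∏_{j ∈ R_i} ∂_{i,j}` of operators acting on the left (so the
rightmost factor is applied first), where, from left to right, `i` increases and `j` decreases
along `R_i`. -/
def tupleMap (m L : ℕ) (R : Fin m → Finset ℕ) : Word m L → Word m L :=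
  ((List.finRange m).flatMap fun i => ((R i).sort (· ≥ ·)).map fun j => loan i j).foldr
    (fun f g => f ∘ g) id

/-- The number `|e_R Ω|` of elements of the image of `e_R`. -/
def imageCount (m L : ℕ) (R : Fin m → Finset ℕ) : ℕ :=
  (Finset.univ.image (tupleMap m L R)).card

/-- The multiplicity `m_R = ∑_{R ⊆ U} (-1)^{|U| - |R|} |e_U Ω|`. -/
def multiplicity (m L : ℕ) (R : Fin m → Finset ℕ) : ℤ :=
  ∑ U ∈ subsetTuples m L with ∀ i, R i ⊆ U i,
    (-1) ^ ((∑ i, (U i).card) - ∑ i, (R i).card) * (imageCount m L U : ℤ)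

/-- The multinomial coefficient `(∑ v_i)! / ∏ (v_i)!`, set to `0` if an entry is negative. -/
def multinomial {m : ℕ} (v : Fin m → ℤ) : ℕ :=
  if ∀ i, 0 ≤ v i then Nat.multinomial Finset.univ fun i => (v i).toNat else 0

/-- The set `I(R)` of contents `n` with `∑ n_i = L`, with `n_i ≠ 0` whenever `1 ∈ R_i`, and with at
most one index `i` such that `n_i + 1 ∈ R_i`. -/
def admissibleContents (m L : ℕ) (R : Fin m → Finset ℕ) : Finset (Fin m → ℕ) :=
  {n ∈ Finset.piAntidiag Finset.univ L |
    (∀ i, 1 ∈ R i → n i ≠ 0) ∧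
      (Finset.univ.filter fun i => n i + 1 ∈ R i).card ≤ 1}

/-- The vector `f_i(R, n) = |{r ∈ R_i : n_i ≥ r - 1}|`. -/
def blockVector {m : ℕ} (R : Fin m → Finset ℕ) (n : Fin m → ℕ) (i : Fin m) : ℕ :=
  ((R i).filter fun r => r ≤ n i + 1).card

/-- The explicit number of fixed points of `e_R`: if every `R_i` is a proper subset of `[L]` and
`∑ min ([L] \ R_i) < L + m`, a sum of multinomial coefficients over `I(R)`, and `1` otherwise. -/
noncomputable def fixedPointFormula (m L : ℕ) (R : Fin m → Finset ℕ) : ℕ :=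
  open scoped Classical in
  if (∀ i, R i ⊂ Finset.Icc 1 L) ∧
      ∑ i, sInf {r : ℕ | r ∈ Finset.Icc 1 L \ R i} < L + m then
    ∑ n ∈ admissibleContents m L R, multinomial fun i => (n i : ℤ) - (blockVector R n i : ℤ)
  else 1

end ToomTsetlin

/-! Each operator acts on prefixes: the first `k` letters of its output depend only on the first `k`
letters of its input (`loanList_append`). A word may therefore be prolonged until every copy in
question exists. Then `∂_{b,j}` only rearranges letter copies, putting copy `(b,j)` next to
`(b,j-1)`, and everything is read off from the relative order of copies (`Precedes`).

In this picture `e_U` attaches each copy to the last copy of its letter with index outside `U` (its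
`root`), or to the front. So `e_U` depends only on the order of the copies outside `U`, is
idempotent, and absorbs each of its factors on the right. A high power of any product `W` of
operators likewise absorbs the factors of `W` (`exists_iterate_run_loanList`). Hence the fixed
points of `W` are as numerous as the image of `e_U`, where `U` is the set of factors of `W`
(`card_fixed_runWord`).

Traces of monomials in the operators are thus the numbers `|e_U Ω|`. Möbius inversion turns the
trace of `T ^ k` into the signed power sum of the weights with coefficients `m_X`
(`trace_runMatrix_mul_pow`), which determines the eigenvalues with multiplicity. Weights `x`
separating all tuples show `0 ≤ m_X`, since `m_X` does not involve `x`.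

The count of fixed words goes letter by letter. Up to length `∑ lead (U b)` a fixed word has exactly
one fixed extension; beyond it, the admissible last letters are explicit
(`tupleRun_fixed_append_iff`), and the recursion by content is Pascal's rule for multinomial
coefficients. -/

namespace ToomTsetlin

/-! ### A single operator: recursion and action on prefixes -/

variable {B : Type*} [DecidableEq B]

/-- Shift a word by one place to make room for the letter `c` in front, until the first copy of
`b`, which is overwritten; if there is none, the last letter is lost. -/
def carry (b : B) : B → List B → List B
  | _, [] => []
  | c, a :: w => if a = b then c :: w else c :: carry b a w

theorem loanList_zero (b : B) (w : List B) : loanList b 0 w = w := by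
  simp [loanList]

theorem loanList_nil (b : B) (j : ℕ) : loanList b j [] = [] := by
  have := length_loanList b j ([] : List B)
  exact List.length_eq_zero_iff.mp this

theorem insertAfterCopy_ne_nil (b : B) (w : List B) (i : ℕ) (h : i ≤ w.count b) :
    insertAfterCopy b i w ≠ [] := by
  intro h0
  have := length_insertAfterCopy b w i h
  rw [h0] at this
  simp at this

/-- For index at least 2 the destination lies behind a copy of `b`, so the front letter is inert.
Together with `loanList_one_cons` this replaces the three cases of the definition by a structural
recursion. -/
theorem loanList_add_two_cons (b a : B) (j : ℕ) (w : List B) :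
    loanList b (j + 2) (a :: w) = a :: loanList b (if a = b then j + 1 else j + 2) w := by
  by_cases hab : a = b
  · subst hab
    by_cases h1 : j + 1 ≤ w.count a
    · simp [loanList, h1, eraseCopy, insertAfterCopy]
    · by_cases h2 : j = w.count a
      · simp [loanList, h2, insertAfterCopy,
          List.dropLast_cons_of_ne_nil (insertAfterCopy_ne_nil a w _ le_rfl)]
      · simp [loanList, h1, h2]
  · by_cases h1 : j + 2 ≤ w.count b
    · simp [loanList, h1, eraseCopy, insertAfterCopy, hab, List.count_cons_of_ne]
    · by_cases h2 : j + 2 = w.count b + 1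
      · have h3 : w.count b = j + 1 := by omega
        simp [loanList, h3, insertAfterCopy, hab, List.count_cons_of_ne,
          List.dropLast_cons_of_ne_nil (insertAfterCopy_ne_nil b w _ h3.ge)]
      · simp [loanList, h1, h2, hab, List.count_cons_of_ne]

theorem carry_eq_of_mem (b : B) (w : List B) :
    ∀ c, b ∈ w → carry b c w = c :: eraseCopy b 1 w := by
  induction w with
  | nil => simp
  | cons a w ih =>
    intro c h
    by_cases hab : a = b
    · simp [carry, eraseCopy, hab]
    · have : b ∈ w := by
        rcases List.mem_cons.mp h with h | h
        · exact absurd h.symm hab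
        · exact h
      simp [carry, eraseCopy, hab, ih a this]

theorem carry_eq_of_notMem (b : B) (w : List B) :
    ∀ c, b ∉ w → carry b c w = (c :: w).dropLast := by
  induction w with
  | nil => simp [carry]
  | cons a w ih =>
    intro c h
    have h1 : a ≠ b := fun h' => h (by simp [h'])
    have h2 : b ∉ w := fun h' => h (by simp [h'])
    simp [carry, h1, ih a h2]

theorem loanList_one_cons (b a : B) (w : List B) :
    loanList b 1 (a :: w) = if a = b then a :: w else b :: carry b a w := by
  by_cases hab : a = b
  · subst hab
    simp [loanList, eraseCopy, insertAfterCopy]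
  · by_cases hb : b ∈ w
    · have : 1 ≤ w.count b := List.count_pos_iff.mpr hb
      simp [loanList, hab, hb, this, carry_eq_of_mem, insertAfterCopy, eraseCopy,
        List.count_cons_of_ne]
    · have : w.count b = 0 := List.count_eq_zero.mpr hb
      simp [loanList, hab, this, carry_eq_of_notMem b w a hb, insertAfterCopy,
        List.count_cons_of_ne]

theorem carry_append_singleton_of_mem (b : B) (w : List B) (a : B) :
    ∀ c, b ∈ w → carry b c (w ++ [a]) = carry b c w ++ [a] := by
  induction w with
  | nil => simp
  | cons d w ih =>
    intro c h
    by_cases hdb : d = b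
    · simp [carry, hdb]
    · have : b ∈ w := by
        rcases List.mem_cons.mp h with h | h
        · exact absurd h.symm hdb
        · exact h
      simp [carry, hdb, ih d this]

theorem carry_append_singleton_of_notMem (b : B) (w : List B) :
    ∀ c, b ∉ w → ∃ d, ∀ a, carry b c (w ++ [a]) = carry b c w ++ [d] := by
  induction w with
  | nil => intro c _; exact ⟨c, fun a => by simp [carry]⟩
  | cons d w ih =>
    intro c h
    have h1 : d ≠ b := fun h' => h (by simp [h'])
    have h2 : b ∉ w := fun h' => h (by simp [h'])
    obtain ⟨x, hx⟩ := ih d h2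
    exact ⟨x, fun a => by simp [carry, h1, hx]⟩

theorem loanList_append_singleton_of_ne (b a : B) (w : List B) :
    ∀ j, w.count b + 1 ≠ j → loanList b j (w ++ [a]) = loanList b j w ++ [a] := by
  induction w with
  | nil =>
    intro j h
    match j with
    | 0 => simp [loanList_zero]
    | 1 => simp at h
    | j + 2 => simp [loanList_add_two_cons, loanList_nil]
  | cons d w ih =>
    intro j h
    match j with
    | 0 => simp [loanList_zero]
    | 1 =>
      simp only [List.cons_append, loanList_one_cons]
      by_cases hdb : d = b
      · simp [hdb]
      · have : b ∈ w := by
          rw [List.count_cons_of_ne hdb] at h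
          exact List.count_pos_iff.mp (by omega)
        simp [hdb, carry_append_singleton_of_mem b w a d this]
    | j + 2 =>
      simp only [List.cons_append, loanList_add_two_cons]
      by_cases hdb : d = b
      · subst hdb
        rw [List.count_cons_self] at h
        simp [ih (j + 1) (by omega)]
      · rw [List.count_cons_of_ne hdb] at h
        simp [hdb, ih (j + 2) (by omega)]

/-- The appended letter is either the missing copy of `b`, which is moved inwards, or another
letter, which falls off while a new `b` is inserted. Both give the same word, so the appended letter
is forgotten. -/
theorem loanList_append_singleton_of_eq (b : B) (w : List B) :
    ∃ c, ∀ a, loanList b (w.count b + 1) (w ++ [a]) = loanList b (w.count b + 1) w ++ [c] := by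
  induction w with
  | nil => exact ⟨b, fun a => by
      simp only [List.count_nil, zero_add, List.nil_append, loanList_nil, loanList_one_cons]
      by_cases h : a = b <;> simp [h, carry]⟩
  | cons d w ih =>
    obtain ⟨c, hc⟩ := ih
    by_cases hdb : d = b
    · subst hdb
      refine ⟨c, fun a => ?_⟩
      simp [List.count_cons_self, loanList_add_two_cons, hc]
    · rw [List.count_cons_of_ne hdb]
      cases hw : w.count b with
      | zero =>
        obtain ⟨x, hx⟩ := carry_append_singleton_of_notMem b w d (List.count_eq_zero.mp hw)
        exact ⟨x, fun a => by simp [loanList_one_cons, hdb, hx]⟩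
      | succ k =>
        rw [hw] at hc
        exact ⟨c, fun a => by simp [loanList_add_two_cons, hdb, hc]⟩

theorem loanList_append (b : B) (j : ℕ) (w t : List B) :
    ∃ t', loanList b j (w ++ t) = loanList b j w ++ t' := by
  induction t using List.reverseRecOn with
  | nil => exact ⟨[], by simp⟩
  | append_singleton t a ih =>
    obtain ⟨t', ht⟩ := ih
    rw [← List.append_assoc]
    by_cases h : (w ++ t).count b + 1 = j
    · subst h
      obtain ⟨c, hc⟩ := loanList_append_singleton_of_eq b (w ++ t)
      exact ⟨t' ++ [c], by rw [hc, ht, List.append_assoc]⟩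
    · exact ⟨t' ++ [a], by
        rw [loanList_append_singleton_of_ne b a _ j h, ht, List.append_assoc]⟩

theorem carry_perm (b : B) (w : List B) : ∀ c, b ∈ w → (b :: carry b c w).Perm (c :: w) := by
  induction w with
  | nil => simp
  | cons a w ih =>
    intro c h
    by_cases hab : a = b
    · subst hab
      simpa [carry] using List.Perm.swap _ _ _
    · have : b ∈ w := by
        rcases List.mem_cons.mp h with h | h
        · exact absurd h.symm hab
        · exact h
      simp only [carry, hab, if_false]
      exact (List.Perm.swap _ _ _).trans ((ih a this).cons c)

theorem loanList_perm (b : B) (w : List B) :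
    ∀ j, w.count b + 1 ≠ j → (loanList b j w).Perm w := by
  induction w with
  | nil => intro j _; simp [loanList_nil]
  | cons d w ih =>
    intro j h
    match j with
    | 0 => simp [loanList_zero]
    | 1 =>
      rw [loanList_one_cons]
      by_cases hdb : d = b
      · simp [hdb]
      · have : b ∈ w := by
          rw [List.count_cons_of_ne hdb] at h
          exact List.count_pos_iff.mp (by omega)
        simpa [hdb] using carry_perm b w d this
    | j + 2 =>
      rw [loanList_add_two_cons]
      by_cases hdb : d = b
      · subst hdb
        rw [List.count_cons_self] at h
        simpa using ih (j + 1) (by omega)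
      · rw [List.count_cons_of_ne hdb] at h
        simpa [hdb] using ih (j + 2) (by omega)

/-! ### Relative order of letter copies -/

/-- The number of letters `c` before the `j`-th copy of `b`. -/
def before (b c : B) : ℕ → List B → ℕ
  | 0, _ => 0
  | _ + 1, [] => 0
  | j + 1, a :: w =>
    if a = b then before b c j w else (if a = c then 1 else 0) + before b c (j + 1) w

theorem before_zero (b c : B) (w : List B) : before b c 0 w = 0 := by
  simp [before]

theorem before_carry_self {b c : B} (k : ℕ) (w : List B) :
    ∀ a, a ≠ b → b ∈ w → before b c (k + 1) (carry b a w) = before b c (k + 2) (a :: w) := by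
  induction w with
  | nil => simp
  | cons d w ih =>
    intro a hab h
    by_cases hdb : d = b
    · simp [carry, before, hdb, hab]
    · have : b ∈ w := by
        rcases List.mem_cons.mp h with h | h
        · exact absurd h.symm hdb
        · exact h
      have := ih d hdb this
      simp only [carry, hdb, if_false]
      simp only [before, hab, hdb, if_false] at this ⊢
      rw [this]

theorem before_carry_of_ne {b c d : B} (hc : c ≠ b) (hd : d ≠ b) (w : List B) :
    ∀ a i, b ∈ w → before c d i (carry b a w) = before c d i (a :: w) := by
  induction w with
  | nil => simp
  | cons e w ih =>
    intro a i h
    cases i with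
    | zero => simp [before]
    | succ i =>
      by_cases heb : e = b
      · subst heb
        cases i <;> simp [carry, before, hc.symm, hd.symm]
      · have : b ∈ w := by
          rcases List.mem_cons.mp h with h | h
          · exact absurd h.symm heb
          · exact h
        simp only [carry, heb, if_false]
        conv_lhs => rw [before]
        conv_rhs => rw [before]
        rw [ih e _ this, ih e _ this]

/-- After the move, copies `j - 1` and `j` of `b` are adjacent and have the same other letters to
their left. Index `0` acts as a virtual copy at the front, which covers `j = 1`. -/
theorem before_loanList_self {b c : B} (w : List B) :
    ∀ i j, 1 ≤ j → j ≤ w.count b →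
      before b c i (loanList b j w) = before b c (if i = j then j - 1 else i) w := by
  induction w with
  | nil => intro i j h1 h2; simp at h2; omega
  | cons a w ih =>
    intro i j h1 h2
    match j, h1 with
    | 1, _ =>
      rw [loanList_one_cons]
      by_cases hab : a = b
      · subst hab
        match i with
        | 0 => simp [before]
        | 1 => simp [before]
        | i + 2 => simp
      · have hb : b ∈ w := by
          rw [List.count_cons_of_ne hab] at h2
          exact List.count_pos_iff.mp (by omega)
        rw [if_neg hab]
        match i with
        | 0 => simp [before]
        | 1 => simp [before]
        | i + 2 =>
          rw [if_neg (by omega), ← before_carry_self i w a hab hb]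
          simp [before]
    | j + 2, _ =>
      rw [loanList_add_two_cons]
      by_cases hab : a = b
      · subst hab
        rw [List.count_cons_self] at h2
        cases i with
        | zero => simp [before]
        | succ i =>
          have := ih i (j + 1) (by omega) (by omega)
          by_cases hij : i = j + 1
          · simp [before, hij] at this ⊢
            exact this
          · simp [before, hij] at this ⊢
            exact this
      · rw [List.count_cons_of_ne hab] at h2
        cases i with
        | zero => simp [before]
        | succ i =>
          have := ih (i + 1) (j + 2) (by omega) (by omega)
          by_cases hij : i = j + 1
          · simp [before, hij, hab] at this ⊢
            exact this
          · simp [before, hij, hab] at this ⊢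
            exact this

theorem before_loanList_of_ne {b c d : B} (hc : c ≠ b) (hd : d ≠ b) (w : List B) :
    ∀ i j, 1 ≤ j → j ≤ w.count b → before c d i (loanList b j w) = before c d i w := by
  induction w with
  | nil => intro i j h1 h2; simp at h2; omega
  | cons a w ih =>
    intro i j h1 h2
    match j, h1 with
    | 1, _ =>
      rw [loanList_one_cons]
      by_cases hab : a = b
      · simp [hab]
      · have hb : b ∈ w := by
          rw [List.count_cons_of_ne hab] at h2
          exact List.count_pos_iff.mp (by omega)
        rw [if_neg hab]
        cases i with
        | zero => simp [before]
        | succ i =>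
          rw [← before_carry_of_ne hc hd w a (i + 1) hb]
          simp [before, hc.symm, hd.symm]
    | j + 2, _ =>
      rw [loanList_add_two_cons]
      have key : ∀ i, before c d i (loanList b (if a = b then j + 1 else j + 2) w) =
          before c d i w := by
        intro i
        by_cases hab : a = b
        · subst hab
          rw [List.count_cons_self] at h2
          simpa using ih i (j + 1) (by omega) (by omega)
        · rw [List.count_cons_of_ne hab] at h2
          simpa [hab] using ih i (j + 2) (by omega) (by omega)
      cases i with
      | zero => simp [before]
      | succ i => simp only [before, key]

theorem before_lt_iff_not {b c : B} (hbc : b ≠ c) (w : List B) :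
    ∀ j i, 1 ≤ j → j ≤ w.count b → 1 ≤ i → i ≤ w.count c →
      (before b c j w < i ↔ ¬ before c b i w < j) := by
  induction w with
  | nil => intro j i h1 h2; simp at h2; omega
  | cons a w ih =>
    intro j i h1 h2 h3 h4
    obtain ⟨j, rfl⟩ : ∃ k, j = k + 1 := ⟨j - 1, by omega⟩
    obtain ⟨i, rfl⟩ : ∃ k, i = k + 1 := ⟨i - 1, by omega⟩
    by_cases hab : a = b
    · subst hab
      rw [List.count_cons_self] at h2
      rw [List.count_cons_of_ne hbc] at h4
      cases j with
      | zero => simp [before, hbc]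
      | succ j =>
        have := ih (j + 1) (i + 1) (by omega) (by omega) h3 h4
        simp only [before, hbc, if_true, if_false]
        rw [this]
        omega
    · by_cases hac : a = c
      · subst hac
        rw [List.count_cons_self] at h4
        rw [List.count_cons_of_ne hab] at h2
        cases i with
        | zero => simp [before, hab]
        | succ i =>
          have := ih (j + 1) (i + 1) h1 h2 (by omega) (by omega)
          simp only [before, hab, if_true, if_false]
          rw [← not_iff_not, not_not, ← not_iff_not.mpr this |>.trans not_not]
          omega
      · rw [List.count_cons_of_ne hab] at h2
        rw [List.count_cons_of_ne hac] at h4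
        simpa [before, hab, hac] using ih (j + 1) (i + 1) h1 h2 h3 h4

/-- A word is determined by its content and the relative order of its letter copies. -/
theorem eq_of_before_lt_iff (w : List B) :
    ∀ w' : List B, (∀ b, w.count b = w'.count b) →
      (∀ b c, b ≠ c → ∀ j i, 1 ≤ j → j ≤ w.count b → 1 ≤ i → i ≤ w.count c →
        (before b c j w < i ↔ before b c j w' < i)) → w = w' := by
  induction w with
  | nil =>
    intro w' h _
    cases w' with
    | nil => rfl
    | cons a w' => have := h a; simp at this
  | cons a w ih =>
    intro w' hc hb
    cases w' with
    | nil => have := hc a; simp at this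
    | cons a' w' =>
      have haa : a = a' := by
        -- If the first letters differed, the first copy of `a` would precede the first copy of `a'`
        -- in one word but not in the other.
        by_contra hne
        have h1 := hc a'
        rw [List.count_cons_self] at h1
        have := (hb a a' hne 1 1 le_rfl (by simp) le_rfl (by omega)).mp (by simp [before])
        simp [before, Ne.symm hne] at this
      subst haa
      have hc' : ∀ b, w.count b = w'.count b := by
        intro b
        have := hc b
        simp only [List.count_cons] at this
        omega
      rw [ih w' hc']
      intro b c hbc j i hj1 hj2 hi1 hi2
      by_cases hab : a = b
      · subst hab
        have := hb a c hbc (j + 1) i (by omega) (by simp; omega) hi1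
          (hi2.trans (List.count_le_count_cons))
        simpa [before] using this
      · obtain ⟨j, rfl⟩ : ∃ k, j = k + 1 := ⟨j - 1, by omega⟩
        by_cases hac : a = c
        · subst hac
          have := hb b a hbc (j + 1) (i + 1) (by omega)
            (hj2.trans (List.count_le_count_cons)) (by omega) (by simp; omega)
          simp [before, hab] at this
          omega
        · have := hb b c hbc (j + 1) i (by omega)
            (hj2.trans (List.count_le_count_cons)) (by omega)
            (hi2.trans (List.count_le_count_cons))
          simpa [before, hab, hac] using this

theorem before_le_count_take {b c : B} (w : List B) :
    ∀ k j, j ≤ (w.take k).count b → before b c j w ≤ (w.take k).count c := by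
  induction w with
  | nil => intro k j h; simp at h; simp [h, before]
  | cons a w ih =>
    intro k j h
    cases k with
    | zero => simp at h; simp [h, before]
    | succ k =>
      cases j with
      | zero => simp [before]
      | succ j =>
        simp only [List.take_succ_cons, List.count_cons] at h ⊢
        by_cases hab : a = b
        · have := ih k j (by simp [hab] at h; omega)
          simp [before, hab]
          omega
        · have := ih k (j + 1) (by simpa [hab] using h)
          by_cases hac : a = c
          · simp [before, hac]
            subst hac
            simp [hab]
            omega
          · simp [before, hab, hac]
            omega

/-! ### Products of operators and the order they induce -/

/-- Apply a sequence of operators to a word, the rightmost one first. -/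
def run (W : List (B × ℕ)) (w : List B) : List B :=
  W.foldr (fun s v => loanList s.1 s.2 v) w

theorem run_nil (w : List B) : run [] w = w := rfl

theorem run_cons (s : B × ℕ) (W : List (B × ℕ)) (w : List B) :
    run (s :: W) w = loanList s.1 s.2 (run W w) := rfl

theorem run_append (V W : List (B × ℕ)) (w : List B) : run (V ++ W) w = run V (run W w) := by
  simp [run, List.foldr_append]

theorem length_run (W : List (B × ℕ)) (w : List B) : (run W w).length = w.length := by
  induction W with
  | nil => rfl
  | cons s W ih => rw [run_cons, length_loanList, ih]

theorem run_append_word (W : List (B × ℕ)) (w t : List B) :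
    ∃ t', run W (w ++ t) = run W w ++ t' := by
  induction W with
  | nil => exact ⟨t, rfl⟩
  | cons s W ih =>
    obtain ⟨t', ht⟩ := ih
    rw [run_cons, run_cons, ht]
    exact loanList_append _ _ _ _

theorem iterate_run_append_word (W : List (B × ℕ)) (N : ℕ) (w t : List B) :
    ∃ t', (run W)^[N] (w ++ t) = (run W)^[N] w ++ t' := by
  induction N generalizing w t with
  | zero => exact ⟨t, rfl⟩
  | succ N ih =>
    obtain ⟨t', ht⟩ := run_append_word W w t
    rw [Function.iterate_succ_apply, Function.iterate_succ_apply, ht]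
    exact ih _ _

theorem length_iterate_run (W : List (B × ℕ)) (N : ℕ) (w : List B) :
    ((run W)^[N] w).length = w.length := by
  induction N generalizing w with
  | zero => rfl
  | succ N ih => rw [Function.iterate_succ_apply, ih, length_run]

/-- `(b, j)` is one of the letter copies in the word `w`. -/
def IsCopy (w : List B) (p : B × ℕ) : Prop := 1 ≤ p.2 ∧ p.2 ≤ w.count p.1

/-- The copy `p` precedes the copy `q`. -/
def Precedes (w : List B) (p q : B × ℕ) : Prop := before p.1 q.1 p.2 w < q.2

theorem count_loanList {w : List B} {s : B × ℕ} (hs : IsCopy w s) (c : B) :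
    (loanList s.1 s.2 w).count c = w.count c :=
  (loanList_perm _ _ _ (by have := hs.2; omega)).count_eq c

theorem count_run {W : List (B × ℕ)} {w : List B} (h : ∀ s ∈ W, IsCopy w s) (c : B) :
    (run W w).count c = w.count c := by
  induction W generalizing c with
  | nil => rfl
  | cons s W ih =>
    have ih' := ih fun s hs => h s (List.mem_cons_of_mem _ hs)
    have hs := h s List.mem_cons_self
    rw [run_cons, count_loanList ⟨hs.1, by rw [ih']; exact hs.2⟩, ih']

theorem isCopy_congr {w w' : List B} (h : ∀ c, w.count c = w'.count c) (p : B × ℕ) :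
    IsCopy w p ↔ IsCopy w' p := by
  simp [IsCopy, h]

theorem precedes_iff_not {w : List B} {p q : B × ℕ} (hpq : p.1 ≠ q.1) (hp : IsCopy w p)
    (hq : IsCopy w q) : Precedes w p q ↔ ¬ Precedes w q p :=
  before_lt_iff_not hpq w _ _ hp.1 hp.2 hq.1 hq.2

theorem precedes_of_zero {w : List B} {b : B} {q : B × ℕ} (hq : IsCopy w q) :
    Precedes w (b, 0) q := by
  simpa [Precedes, before] using Nat.pos_of_ne_zero (by have := hq.1; omega)

theorem eq_of_precedes_iff {w w' : List B} (h : ∀ c, w.count c = w'.count c)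
    (hb : ∀ p q, p.1 ≠ q.1 → IsCopy w p → IsCopy w q → (Precedes w p q ↔ Precedes w' p q)) :
    w = w' :=
  eq_of_before_lt_iff w w' h fun b c hbc j i h1 h2 h3 h4 =>
    hb (b, j) (c, i) hbc ⟨h1, h2⟩ ⟨h3, h4⟩

theorem precedes_loanList_left {w : List B} {s q : B × ℕ} (hs : IsCopy w s) :
    Precedes (loanList s.1 s.2 w) s q ↔ Precedes w (s.1, s.2 - 1) q := by
  simp [Precedes, before_loanList_self w s.2 s.2 hs.1 hs.2]

theorem precedes_loanList_right {w : List B} {s p : B × ℕ} (hs : IsCopy w s) (hp : IsCopy w p)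
    (h : p.1 ≠ s.1) :
    Precedes (loanList s.1 s.2 w) p s ↔ ¬ Precedes w (s.1, s.2 - 1) p := by
  have hc := count_loanList hs
  rw [precedes_iff_not h ((isCopy_congr hc _).2 hp) ((isCopy_congr hc _).2 hs),
    precedes_loanList_left hs]

theorem precedes_loanList_of_ne {w : List B} {s p q : B × ℕ} (hs : IsCopy w s)
    (hp : IsCopy w p) (hq : IsCopy w q) (hpq : p.1 ≠ q.1) (hps : p ≠ s) (hqs : q ≠ s) :
    Precedes (loanList s.1 s.2 w) p q ↔ Precedes w p q := by
  have key : ∀ p q : B × ℕ, p.1 ≠ q.1 → p ≠ s → p.1 = s.1 →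
      (Precedes (loanList s.1 s.2 w) p q ↔ Precedes w p q) := by
    intro p q hpq hps h1
    have h2 : p.2 ≠ s.2 := fun h => hps (Prod.ext h1 h)
    simp [Precedes, h1, before_loanList_self w p.2 s.2 hs.1 hs.2, h2]
  have hc := count_loanList hs
  by_cases h1 : p.1 = s.1
  · exact key p q hpq hps h1
  · by_cases h2 : q.1 = s.1
    · rw [precedes_iff_not hpq ((isCopy_congr hc _).2 hp) ((isCopy_congr hc _).2 hq),
        precedes_iff_not hpq hp hq, key q p hpq.symm hqs h2]
    · simp [Precedes, before_loanList_of_ne h1 h2 w p.2 s.2 hs.1 hs.2]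

/-! ### Iterated products forget the copies they move -/

/-- The pairs of copies whose relative order is controlled after `d` rounds of operators from `S`
and the operators from `T` of the next round. -/
def Settled (S T : Set (B × ℕ)) (d : ℕ) (p q : B × ℕ) : Prop :=
  p.2 + q.2 ≤ d ∨ (p ∉ S ∧ q ∉ S) ∨ (p.2 + q.2 ≤ d + 1 ∧ (p ∈ T ∨ q ∈ T))

/-- Two words of the same content in which all pairs of copies satisfying `C` are in the same
relative order. -/
structure AgreeOn (C : B × ℕ → B × ℕ → Prop) (w w' : List B) : Prop where
  count_eq : ∀ c, w.count c = w'.count c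
  precedes_iff : ∀ p q, p.1 ≠ q.1 → IsCopy w p → IsCopy w q → C p q →
    (Precedes w p q ↔ Precedes w' p q)

/-- The new order of `s` and `q` is the old order of `(s.1, s.2 - 1)` and `q`. The index sum has
dropped by one, so that pair was already settled, or the predecessor is the virtual front copy.
Pairs avoiding `s` do not change. -/
theorem AgreeOn.loanList {S T : Set (B × ℕ)} {d : ℕ} {w w' : List B} {s : B × ℕ}
    (h : AgreeOn (Settled S T d) w w') (hS : s ∈ S) (hs : IsCopy w s) :
    AgreeOn (Settled S (insert s T) d) (loanList s.1 s.2 w) (loanList s.1 s.2 w') := by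
  have hs' := (isCopy_congr h.count_eq s).1 hs
  have hc := count_loanList hs
  have hc' := count_loanList hs'
  refine ⟨fun c => by rw [hc, hc', h.count_eq], ?_⟩
  intro p q hpq hp hq hC
  rw [isCopy_congr hc] at hp hq
  have hp' := (isCopy_congr h.count_eq p).1 hp
  have hq' := (isCopy_congr h.count_eq q).1 hq
  have key : ∀ q, IsCopy w q → s.1 ≠ q.1 → Settled S (insert s T) d s q →
      (Precedes w (s.1, s.2 - 1) q ↔ Precedes w' (s.1, s.2 - 1) q) := by
    intro q hq hsq hC
    rcases Nat.eq_zero_or_pos (s.2 - 1) with h0 | h0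
    · rw [h0]
      exact iff_of_true (precedes_of_zero hq)
        (precedes_of_zero ((isCopy_congr h.count_eq q).1 hq))
    · refine h.precedes_iff _ _ hsq ⟨h0, (Nat.sub_le _ _).trans hs.2⟩ hq (Or.inl ?_)
      have := hs.1
      simp only
      rcases hC with hC | hC | hC
      · omega
      · exact absurd hS hC.1
      · omega
  by_cases hps : p = s
  · subst hps
    rw [precedes_loanList_left hs, precedes_loanList_left hs']
    exact key q hq hpq hC
  · by_cases hqs : q = s
    · subst hqs
      rw [precedes_loanList_right hs hp hpq, precedes_loanList_right hs' hp' hpq]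
      refine not_congr (key p hp hpq.symm ?_)
      simp only [Settled] at hC ⊢
      rw [add_comm q.2, and_comm (a := q ∉ S), or_comm (a := q ∈ insert q T)]
      exact hC
    · rw [precedes_loanList_of_ne hs hp hq hpq hps hqs,
        precedes_loanList_of_ne hs' hp' hq' hpq hps hqs]
      refine h.precedes_iff p q hpq hp hq ?_
      simpa [Settled, hps, hqs] using hC

theorem AgreeOn.run {S : Set (B × ℕ)} {d : ℕ} {w w' : List B} {W : List (B × ℕ)}
    (h : AgreeOn (Settled S ∅ d) w w') (hS : ∀ s ∈ W, s ∈ S) (hs : ∀ s ∈ W, IsCopy w s) :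
    AgreeOn (Settled S {s | s ∈ W} d) (run W w) (run W w') := by
  induction W with
  | nil => simpa [run_nil] using h
  | cons s W ih =>
    have ih' := ih (fun s hs => hS s (List.mem_cons_of_mem _ hs))
      (fun t ht => hs t (List.mem_cons_of_mem _ ht))
    have hc := count_run fun t ht => hs t (List.mem_cons_of_mem _ ht)
    have := ih'.loanList (hS s List.mem_cons_self)
      ((isCopy_congr hc s).2 (hs s List.mem_cons_self))
    rw [run_cons, run_cons]
    convert this using 2
    ext t
    simp

theorem AgreeOn.iterate_run {w w' : List B} {W : List (B × ℕ)}
    (h : AgreeOn (fun p q => p ∉ W ∧ q ∉ W) w w') (hs : ∀ s ∈ W, IsCopy w s) (N : ℕ) :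
    AgreeOn (Settled {s | s ∈ W} ∅ N) ((ToomTsetlin.run W)^[N] w)
      ((ToomTsetlin.run W)^[N] w') ∧ ∀ c, ((ToomTsetlin.run W)^[N] w).count c = w.count c := by
  induction N with
  | zero =>
    refine ⟨⟨h.count_eq, fun p q hpq hp hq hC => h.precedes_iff p q hpq hp hq ?_⟩, fun c => rfl⟩
    rcases hC with hC | hC | hC
    · have := hp.1
      omega
    · exact hC
    · simp at hC
  | succ N ih =>
    obtain ⟨ih, hc⟩ := ih
    have hs' : ∀ s ∈ W, IsCopy ((ToomTsetlin.run W)^[N] w) s :=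
      fun s h => (isCopy_congr hc s).2 (hs s h)
    have := ih.run (W := W) (fun s hs => hs) hs'
    rw [Function.iterate_succ_apply', Function.iterate_succ_apply']
    refine ⟨⟨this.count_eq, fun p q hpq hp hq hC =>
      this.precedes_iff p q hpq hp hq ?_⟩, fun c => by rw [count_run hs', hc]⟩
    -- After a whole round `T` equals `S`: a pair of index sum at most `N + 1` either avoids `S` or
    -- meets `T`, and is settled in both cases.
    simp only [Settled, Set.mem_ofPred_eq, Set.mem_empty_iff_false, or_false, and_false] at hC ⊢
    tauto

/-- Indices of copies are bounded by the length of the word, so after twice that many rounds every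
pair is settled. -/
theorem iterate_run_eq {w w' : List B} {W : List (B × ℕ)}
    (h : AgreeOn (fun p q => p ∉ W ∧ q ∉ W) w w') (hs : ∀ s ∈ W, IsCopy w s) {N : ℕ}
    (hN : 2 * w.length ≤ N) : (run W)^[N] w = (run W)^[N] w' := by
  obtain ⟨h1, h2⟩ := h.iterate_run hs N
  refine eq_of_precedes_iff h1.count_eq fun p q hpq hp hq =>
    h1.precedes_iff p q hpq hp hq (Or.inl ?_)
  have hp' := ((isCopy_congr h2 p).1 hp).2.trans List.count_le_length
  have hq' := ((isCopy_congr h2 q).1 hq).2.trans List.count_le_length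
  omega

theorem exists_forall_le_count [Fintype B] (K : ℕ) : ∃ t : List B, ∀ b, K ≤ t.count b := by
  induction K with
  | zero => exact ⟨[], by simp⟩
  | succ K ih =>
    obtain ⟨t, ht⟩ := ih
    refine ⟨Finset.univ.toList ++ t, fun b => ?_⟩
    have : 0 < (Finset.univ : Finset B).toList.count b := List.count_pos_iff.mpr (by simp)
    have := ht b
    rw [List.count_append]
    omega

theorem agreeOn_loanList {w : List B} {s : B × ℕ} (hs : IsCopy w s) {C : B × ℕ → B × ℕ → Prop}
    (hC : ∀ p q, C p q → p ≠ s ∧ q ≠ s) : AgreeOn C (loanList s.1 s.2 w) w := by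
  have hc := count_loanList hs
  refine ⟨hc, fun p q hpq hp hq h => ?_⟩
  rw [isCopy_congr hc] at hp hq
  exact precedes_loanList_of_ne hs hp hq hpq (hC p q h).1 (hC p q h).2

/-- A sufficiently high power of a product of operators absorbs its factors on the right. -/
theorem exists_iterate_run_loanList [Fintype B] (W : List (B × ℕ)) (hW : ∀ s ∈ W, 1 ≤ s.2)
    (L : ℕ) : ∃ N, ∀ s ∈ W, ∀ w : List B, w.length = L →
      (run W)^[N] (loanList s.1 s.2 w) = (run W)^[N] w := by
  -- The padding `t` holds enough copies of each letter that no operator of `W` ever has to borrow.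
  -- The sum of the indices is a crude bound for each of them, and `N` depends on `w` only through
  -- its length.
  obtain ⟨t, ht⟩ := exists_forall_le_count (B := B) ((W.map Prod.snd).sum)
  refine ⟨2 * (L + t.length), fun s hs w hw => ?_⟩
  have hcopy : ∀ s ∈ W, IsCopy (w ++ t) s := fun s hs => by
    refine ⟨hW s hs, ?_⟩
    have h1 := List.le_sum_of_mem (List.mem_map_of_mem (f := Prod.snd) hs)
    have h2 := ht s.1
    rw [List.count_append]
    omega
  obtain ⟨t₁, h₁⟩ := loanList_append s.1 s.2 w t
  obtain ⟨t₂, h₂⟩ := iterate_run_append_word W (2 * (L + t.length)) (loanList s.1 s.2 w) t₁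
  obtain ⟨t₃, h₃⟩ := iterate_run_append_word W (2 * (L + t.length)) w t
  have key := iterate_run_eq (W := W) (N := 2 * (L + t.length))
    (agreeOn_loanList (C := fun p q => p ∉ W ∧ q ∉ W) (hcopy s hs)
      fun p q h => ⟨fun h' => h.1 (h' ▸ hs), fun h' => h.2 (h' ▸ hs)⟩)
    (fun s' hs' => (isCopy_congr (count_loanList (hcopy s hs)) s').2 (hcopy s' hs'))
    (by rw [length_loanList, List.length_append, hw])
  rw [h₁, h₂, h₃] at key
  exact (List.append_inj key (by simp [length_iterate_run, length_loanList])).1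

/-! ### The order of copies after `e_U` -/

/-- The largest element of the complement of `U` among `1, …, j`, or `0` if there is none. -/
def root (U : Finset ℕ) : ℕ → ℕ
  | 0 => 0
  | j + 1 => if j + 1 ∈ U then root U j else j + 1

theorem root_congr {U V : Finset ℕ} (i : ℕ) (h : ∀ k, 1 ≤ k → k ≤ i → (k ∈ U ↔ k ∈ V)) :
    root U i = root V i := by
  induction i with
  | zero => rfl
  | succ i ih =>
    simp only [root, h (i + 1) (by omega) le_rfl, ih fun k h1 h2 => h k h1 (by omega)]

theorem root_of_notMem {U : Finset ℕ} {i : ℕ} (h : i ∉ U) : root U i = i := by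
  cases i with
  | zero => rfl
  | succ i => simp [root, h]

theorem root_of_mem {U : Finset ℕ} {i : ℕ} (h : i ∈ U) : root U i = root U (i - 1) := by
  cases i with
  | zero => rfl
  | succ i => simp [root, h]

theorem root_le (U : Finset ℕ) (i : ℕ) : root U i ≤ i := by
  induction i with
  | zero => simp [root]
  | succ i ih =>
    rw [root]
    split_ifs <;> omega

theorem root_notMem {U : Finset ℕ} {i : ℕ} (h : root U i ≠ 0) : root U i ∉ U := by
  induction i with
  | zero => simp [root] at h
  | succ i ih =>
    rw [root] at h ⊢
    split_ifs at h ⊢ with h1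
    · exact ih h
    · exact h1

/-- The smallest index acts first, so copy `j` is moved behind a copy `j - 1` that is already in its
final place. Runs of consecutive indices thus collapse onto their root. -/
theorem before_run_letter {c d : B} (l : List ℕ) (hl : l.Pairwise (· > ·))
    (w : List B) (hw : ∀ j ∈ l, IsCopy w (c, j)) (i : ℕ) :
    before c d i (run (l.map fun j => (c, j)) w) = before c d (root l.toFinset i) w := by
  induction l generalizing i with
  | nil => rw [root_of_notMem (by simp)]; rfl
  | cons j l ih =>
    rw [List.pairwise_cons] at hl
    have hw' : ∀ k ∈ l, IsCopy w (c, k) := fun k hk => hw k (List.mem_cons_of_mem _ hk)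
    have hj := hw j List.mem_cons_self
    have hc := count_run (W := l.map fun j => (c, j)) (w := w) (by simpa using hw')
    rw [List.map_cons, run_cons, before_loanList_self _ _ _ hj.1 (by rw [hc]; exact hj.2),
      ih hl.2 hw']
    congr 1
    have hj1 : 1 ≤ j := hj.1
    have key : ∀ i, i < j → root l.toFinset i = root (j :: l).toFinset i := fun i hi =>
      root_congr i fun k h1 h2 => by
        have : k ≠ j := by omega
        simp [this]
    by_cases hij : i = j
    · subst hij
      rw [if_pos rfl, root_of_mem (i := i) (by simp), key _ (by omega)]
    · rw [if_neg hij]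
      by_cases hlt : i < j
      · exact key i hlt
      · have : i ∉ l := fun h => by have := hl.1 i h; omega
        rw [root_of_notMem (by simpa using this), root_of_notMem (by simp [hij, this])]

theorem before_run_letter_of_ne {b c d : B} (hc : c ≠ b) (hd : d ≠ b) (l : List ℕ)
    (w : List B) (hw : ∀ j ∈ l, IsCopy w (b, j)) (i : ℕ) :
    before c d i (run (l.map fun j => (b, j)) w) = before c d i w := by
  induction l with
  | nil => rfl
  | cons j l ih =>
    have hw' : ∀ k ∈ l, IsCopy w (b, k) := fun k hk => hw k (List.mem_cons_of_mem _ hk)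
    have hj := hw j List.mem_cons_self
    have hcount := count_run (W := l.map fun j => (b, j)) (w := w) (by simpa using hw')
    rw [List.map_cons, run_cons,
      before_loanList_of_ne hc hd _ _ _ hj.1 (by rw [hcount]; exact hj.2), ih hw']

/-- The sequence of operators `∂_{b,j}` with `j ∈ U_b`, sorted by increasing letters (as listed in
`l`) and, for each letter, by decreasing `j`. -/
def tupleList (U : B → Finset ℕ) (l : List B) : List (B × ℕ) :=
  l.flatMap fun b => ((U b).sort (· ≥ ·)).map fun j => (b, j)

theorem tupleList_cons {B : Type*} (U : B → Finset ℕ) (b : B) (l : List B) :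
    tupleList U (b :: l) = ((U b).sort (· ≥ ·)).map (fun j => (b, j)) ++ tupleList U l := by
  simp [tupleList]

theorem mem_tupleList {B : Type*} {U : B → Finset ℕ} {l : List B} {s : B × ℕ} :
    s ∈ tupleList U l ↔ s.1 ∈ l ∧ s.2 ∈ U s.1 := by
  obtain ⟨b, j⟩ := s
  simp [tupleList]

theorem before_run_tupleList_of_notMem {U : B → Finset ℕ} {c d : B} (l : List B) (hc : c ∉ l)
    (hd : d ∉ l) (w : List B) (hw : ∀ b, ∀ j ∈ U b, IsCopy w (b, j)) (i : ℕ) :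
    before c d i (run (tupleList U l) w) = before c d i w := by
  induction l with
  | nil => rfl
  | cons a l ih =>
    have hcount := count_run (W := tupleList U l) (w := w)
      fun s hs => hw s.1 s.2 (mem_tupleList.1 hs).2
    simp only [List.mem_cons, not_or] at hc hd
    rw [tupleList_cons, run_append, before_run_letter_of_ne hc.1 hd.1 _ _
      (fun j hj => (isCopy_congr hcount _).2 (hw a j (by simpa using hj))), ih hc.2 hd.2]

theorem before_run_tupleList_of_mem {U : B → Finset ℕ} {c d : B} (l : List B) (hl : l.Nodup)
    (hc : c ∈ l) (hd : d ∉ l) (w : List B) (hw : ∀ b, ∀ j ∈ U b, IsCopy w (b, j)) (i : ℕ) :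
    before c d i (run (tupleList U l) w) = before c d (root (U c) i) w := by
  induction l with
  | nil => simp at hc
  | cons a l ih =>
    have hcount := count_run (W := tupleList U l) (w := w)
      fun s hs => hw s.1 s.2 (mem_tupleList.1 hs).2
    have hcopy : ∀ j ∈ (U a).sort (· ≥ ·), IsCopy (run (tupleList U l) w) (a, j) :=
      fun j hj => (isCopy_congr hcount _).2 (hw a j (by simpa using hj))
    simp only [List.mem_cons, not_or] at hd
    rw [List.nodup_cons] at hl
    rw [tupleList_cons, run_append]
    by_cases hca : c = a
    · subst hca
      rw [before_run_letter _ (Finset.sortedGT_sort _).pairwise _ hcopy,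
        before_run_tupleList_of_notMem l hl.1 hd.2 w hw, Finset.sort_toFinset]
    · rw [before_run_letter_of_ne hca hd.1 _ _ hcopy,
        ih hl.2 ((List.mem_cons.1 hc).resolve_left hca) hd.2]

/-- The block of the smaller letter acts later. Hence among copies sent to the front (root `0`) the
smaller letter comes first, while other copies inherit the order of their roots. -/
theorem precedes_run_tupleList_of_mem [LinearOrder B] {U : B → Finset ℕ} (l : List B)
    (hl : l.Pairwise (· < ·)) (w : List B) (hw : ∀ b, ∀ j ∈ U b, IsCopy w (b, j))
    {p q : B × ℕ} (hp : IsCopy w p) (hq : IsCopy w q) (hpl : p.1 ∈ l) (hql : q.1 ∈ l)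
    (hpq : p.1 < q.1) :
    Precedes (run (tupleList U l) w) p q ↔ root (U p.1) p.2 = 0 ∨ (root (U q.1) q.2 ≠ 0 ∧
      Precedes w (p.1, root (U p.1) p.2) (q.1, root (U q.1) q.2)) := by
  induction l with
  | nil => simp at hpl
  | cons a l ih =>
    have hcount := count_run (W := tupleList U l) (w := w)
      fun s hs => hw s.1 s.2 (mem_tupleList.1 hs).2
    have hcopy : ∀ j ∈ (U a).sort (· ≥ ·), IsCopy (run (tupleList U l) w) (a, j) :=
      fun j hj => (isCopy_congr hcount _).2 (hw a j (by simpa using hj))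
    rw [List.pairwise_cons] at hl
    have hq0 : root (U q.1) q.2 ≠ 0 → IsCopy w (q.1, root (U q.1) q.2) := fun h =>
      ⟨Nat.pos_of_ne_zero h, (root_le _ _).trans hq.2⟩
    have hqa : q.1 ≠ a := by
      rintro rfl
      rcases List.mem_cons.1 hpl with h | h
      · exact hpq.ne h
      · exact (hl.1 _ h).not_gt hpq
    have hql' := (List.mem_cons.1 hql).resolve_left hqa
    rw [tupleList_cons, run_append]
    by_cases hpa : p.1 = a
    · subst hpa
      have hpl' : p.1 ∉ l := fun h => (hl.1 _ h).ne rfl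
      unfold Precedes
      rw [before_run_letter _ (Finset.sortedGT_sort _).pairwise _ hcopy,
        Finset.sort_toFinset]
      by_cases h0 : root (U p.1) p.2 = 0
      · simp [h0, before_zero]
        exact hq.1
      · have hp0 : IsCopy w (p.1, root (U p.1) p.2) :=
          ⟨Nat.pos_of_ne_zero h0, (root_le _ _).trans hp.2⟩
        have h1 := precedes_iff_not (w := run (tupleList U l) w)
          (p := (p.1, root (U p.1) p.2)) (q := q) hpq.ne ((isCopy_congr hcount _).2 hp0)
          ((isCopy_congr hcount _).2 hq)
        simp only [Precedes] at h1
        rw [h1, before_run_tupleList_of_mem l (hl.2.imp fun h => h.ne) hql' hpl' w hw]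
        simp only [h0, false_or]
        by_cases h2 : root (U q.1) q.2 = 0
        · simp [h2, before_zero]
          exact h0
        · have h3 := precedes_iff_not (p := (p.1, root (U p.1) p.2))
            (q := (q.1, root (U q.1) q.2)) hpq.ne hp0 (hq0 h2)
          simp only [Precedes] at h3
          simp [h2, h3]
    · rw [← ih hl.2 ((List.mem_cons.1 hpl).resolve_left hpa) hql']
      unfold Precedes
      rw [before_run_letter_of_ne hpa hqa _ _ hcopy]

/-- The map `e_U` on lists. -/
def tupleRun {m : ℕ} (U : Fin m → Finset ℕ) (w : List (Fin m)) : List (Fin m) :=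
  run (tupleList U (List.finRange m)) w

theorem precedes_tupleRun {m : ℕ} {U : Fin m → Finset ℕ} {w : List (Fin m)}
    (hw : ∀ b, ∀ j ∈ U b, IsCopy w (b, j)) {p q : Fin m × ℕ} (hp : IsCopy w p)
    (hq : IsCopy w q) (hpq : p.1 ≠ q.1) :
    Precedes (tupleRun U w) p q ↔
      (root (U p.1) p.2 = 0 ∧ (root (U q.1) q.2 = 0 → p.1 < q.1)) ∨
      (root (U p.1) p.2 ≠ 0 ∧ root (U q.1) q.2 ≠ 0 ∧
        Precedes w (p.1, root (U p.1) p.2) (q.1, root (U q.1) q.2)) := by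
  have hcount := count_run (W := tupleList U (List.finRange m)) (w := w)
    fun s hs => hw s.1 s.2 (mem_tupleList.1 hs).2
  have hsorted : (List.finRange m).Pairwise (· < ·) := List.pairwise_lt_finRange m
  rcases hpq.lt_or_gt with h | h
  · rw [tupleRun, precedes_run_tupleList_of_mem _ hsorted w hw hp hq (by simp) (by simp) h]
    by_cases h1 : root (U p.1) p.2 = 0 <;> simp [h1, h]
  · rw [tupleRun, precedes_iff_not hpq ((isCopy_congr hcount _).2 hp)
      ((isCopy_congr hcount _).2 hq),
      precedes_run_tupleList_of_mem _ hsorted w hw hq hp (by simp) (by simp) h]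
    by_cases h1 : root (U p.1) p.2 = 0
    · by_cases h2 : root (U q.1) q.2 = 0 <;> simp [h1, h2, h.not_gt]
    · by_cases h2 : root (U q.1) q.2 = 0
      · simp [h1, h2]
      · rw [precedes_iff_not (w := w) (p := (p.1, root (U p.1) p.2))
          (q := (q.1, root (U q.1) q.2)) hpq
          ⟨Nat.pos_of_ne_zero h1, (root_le _ _).trans hp.2⟩
          ⟨Nat.pos_of_ne_zero h2, (root_le _ _).trans hq.2⟩]
        simp [h1, h2]

theorem exists_add_one_notMem (U : Finset ℕ) : ∃ n, n + 1 ∉ U :=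
  ⟨U.sup id, fun h => (Nat.lt_succ_self (U.sup id)).not_ge (Finset.le_sup (f := id) h)⟩

/-- The length of the maximal initial segment `{1, …, r}` contained in `U`. -/
def lead (U : Finset ℕ) : ℕ := Nat.find (exists_add_one_notMem U)

theorem lead_add_one_notMem (U : Finset ℕ) : lead U + 1 ∉ U :=
  Nat.find_spec (exists_add_one_notMem U)

theorem mem_of_le_lead {U : Finset ℕ} {k : ℕ} (h1 : 1 ≤ k) (h2 : k ≤ lead U) : k ∈ U := by
  have := Nat.find_min (exists_add_one_notMem U) (m := k - 1) (by unfold lead at h2; omega)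
  rw [not_not] at this
  rwa [Nat.sub_add_cancel h1] at this

theorem root_eq_zero_iff (U : Finset ℕ) (j : ℕ) : root U j = 0 ↔ j ≤ lead U := by
  induction j with
  | zero => simp [root]
  | succ j ih =>
    rw [root]
    split_ifs with h
    · rw [ih]
      refine ⟨fun h' => ?_, fun h' => by omega⟩
      rcases h'.eq_or_lt with h'' | h''
      · exact absurd (h'' ▸ h) (lead_add_one_notMem U)
      · exact h''
    · exact ⟨fun h' => h'.elim, fun h' => absurd (mem_of_le_lead (by omega) h') h⟩

/-! ### Transfer to words of arbitrary length -/

section Truncation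

variable {m : ℕ} {U : Fin m → Finset ℕ}

theorem length_tupleRun (w : List (Fin m)) : (tupleRun U w).length = w.length :=
  length_run _ _

theorem count_tupleRun {w : List (Fin m)} (hw : ∀ b, ∀ j ∈ U b, IsCopy w (b, j)) (c : Fin m) :
    (tupleRun U w).count c = w.count c :=
  count_run (fun s hs => hw s.1 s.2 (mem_tupleList.1 hs).2) c

/-- Every word can be prolonged to one which has all copies referred to by `U`. -/
theorem exists_extension (hU : ∀ b, 0 ∉ U b) :
    ∃ t : List (Fin m), ∀ w, (∀ b, ∀ j ∈ U b, IsCopy (w ++ t) (b, j)) ∧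
      ∀ b, IsCopy (w ++ t) (b, lead (U b) + 1) := by
  obtain ⟨t, ht⟩ := exists_forall_le_count (B := Fin m) (∑ b, ((U b).sup id + (lead (U b) + 1)))
  have key : ∀ b, (U b).sup id + (lead (U b) + 1) ≤ t.count b := fun b =>
    (Finset.single_le_sum (f := fun b => (U b).sup id + (lead (U b) + 1))
      (fun _ _ => Nat.zero_le _) (Finset.mem_univ b)).trans (ht b)
  refine ⟨t, fun w => ⟨fun b j hj => ⟨?_, ?_⟩, fun b => ⟨by simp, ?_⟩⟩⟩
  · exact Nat.pos_of_ne_zero fun h => hU b (by simp at h; exact h ▸ hj)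
  · have h1 : j ≤ (U b).sup id := Finset.le_sup (f := id) hj
    have h2 := key b
    simp only [List.count_append]
    omega
  · have h2 := key b
    simp only [List.count_append]
    omega

theorem isCopy_root {w : List (Fin m)} {p : Fin m × ℕ} (hp : IsCopy w p)
    (h : root (U p.1) p.2 ≠ 0) : IsCopy w (p.1, root (U p.1) p.2) :=
  ⟨Nat.pos_of_ne_zero h, (root_le _ _).trans hp.2⟩

/-- Nonzero roots lie outside `U`, so only the order among copies outside `U` enters. Those copies
are their own roots, whence `agreeOn_tupleRun` and idempotence. -/
theorem tupleRun_eq_of_agreeOn {w w' : List (Fin m)} (hw : ∀ b, ∀ j ∈ U b, IsCopy w (b, j))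
    (h : AgreeOn (fun p q => p.2 ∉ U p.1 ∧ q.2 ∉ U q.1) w w') : tupleRun U w = tupleRun U w' := by
  have hw' : ∀ b, ∀ j ∈ U b, IsCopy w' (b, j) :=
    fun b j hj => (isCopy_congr h.count_eq _).1 (hw b j hj)
  refine eq_of_precedes_iff (fun c => by rw [count_tupleRun hw, count_tupleRun hw', h.count_eq])
    fun p q hpq hp hq => ?_
  rw [isCopy_congr (count_tupleRun hw)] at hp hq
  rw [precedes_tupleRun hw hp hq hpq, precedes_tupleRun hw' ((isCopy_congr h.count_eq _).1 hp)
    ((isCopy_congr h.count_eq _).1 hq) hpq]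
  refine or_congr_right (and_congr_right fun h1 => and_congr_right fun h2 => ?_)
  exact h.precedes_iff _ _ hpq (isCopy_root hp h1) (isCopy_root hq h2)
    ⟨root_notMem h1, root_notMem h2⟩

theorem agreeOn_tupleRun {w : List (Fin m)} (hw : ∀ b, ∀ j ∈ U b, IsCopy w (b, j)) :
    AgreeOn (fun p q => p.2 ∉ U p.1 ∧ q.2 ∉ U q.1) (tupleRun U w) w := by
  refine ⟨count_tupleRun hw, fun p q hpq hp hq h => ?_⟩
  rw [isCopy_congr (count_tupleRun hw)] at hp hq
  have h1 : p.2 ≠ 0 := by have := hp.1; omega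
  have h2 : q.2 ≠ 0 := by have := hq.1; omega
  rw [precedes_tupleRun hw hp hq hpq, root_of_notMem h.1, root_of_notMem h.2]
  simp [h1, h2]

theorem tupleRun_append (w t : List (Fin m)) :
    ∃ t', tupleRun U (w ++ t) = tupleRun U w ++ t' := run_append_word _ _ _

theorem tupleRun_tupleRun (hU : ∀ b, 0 ∉ U b) (w : List (Fin m)) :
    tupleRun U (tupleRun U w) = tupleRun U w := by
  obtain ⟨t, ht⟩ := exists_extension hU
  have hw := (ht w).1
  have key := tupleRun_eq_of_agreeOn
    (fun b j hj => (isCopy_congr (count_tupleRun hw) _).2 (hw b j hj)) (agreeOn_tupleRun hw)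
  obtain ⟨t₁, h₁⟩ := tupleRun_append (U := U) w t
  obtain ⟨t₂, h₂⟩ := tupleRun_append (U := U) (tupleRun U w) t₁
  rw [h₁, h₂] at key
  exact (List.append_inj key (by simp [length_tupleRun])).1

theorem tupleRun_loanList (hU : ∀ b, 0 ∉ U b) {b : Fin m} {j : ℕ} (hj : j ∈ U b)
    (w : List (Fin m)) : tupleRun U (loanList b j w) = tupleRun U w := by
  obtain ⟨t, ht⟩ := exists_extension hU
  have hw := (ht w).1
  have hs := hw b j hj
  have key := tupleRun_eq_of_agreeOn
    (fun c i hi => (isCopy_congr (count_loanList hs) _).2 (hw c i hi))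
    (agreeOn_loanList hs fun p q h =>
      ⟨fun h' => h.1 (by rw [h']; exact hj), fun h' => h.2 (by rw [h']; exact hj)⟩)
  obtain ⟨t₁, h₁⟩ := loanList_append b j w t
  obtain ⟨t₂, h₂⟩ := tupleRun_append (U := U) (loanList b j w) t₁
  obtain ⟨t₃, h₃⟩ := tupleRun_append (U := U) w t
  rw [h₁, h₂, h₃] at key
  exact (List.append_inj key (by simp [length_tupleRun, length_loanList])).1

/-- Copies `j - 1` and `j` share a nonzero root, so `e_U` already places them in the same position
relative to all other letters. For `j ≤ lead (U b)` the common root is the front, where several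
letters compete, and the argument breaks down. -/
theorem loanList_tupleRun (hU : ∀ b, 0 ∉ U b) {b : Fin m} {j : ℕ} (hj : j ∈ U b)
    (hlead : lead (U b) < j) (w : List (Fin m)) :
    loanList b j (tupleRun U w) = tupleRun U w := by
  obtain ⟨t, ht⟩ := exists_extension hU
  have hw := (ht w).1
  have hc := count_tupleRun hw
  have hs : IsCopy (tupleRun U (w ++ t)) (b, j) := (isCopy_congr hc _).2 (hw b j hj)
  have hroot : root (U b) j ≠ 0 := fun h => by rw [root_eq_zero_iff] at h; omega
  have hpred : root (U b) (j - 1) = root (U b) j := (root_of_mem hj).symm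
  have hcopy : IsCopy (w ++ t) (b, j - 1) :=
    ⟨Nat.pos_of_ne_zero fun h => hroot (by rw [← hpred, show j - 1 = 0 from h]; rfl),
      (Nat.sub_le _ _).trans (hw b j hj).2⟩
  have hleft : ∀ q : Fin m × ℕ, b ≠ q.1 → IsCopy (w ++ t) q →
      (Precedes (tupleRun U (w ++ t)) (b, j - 1) q ↔
        Precedes (tupleRun U (w ++ t)) (b, j) q) := fun q hbq hq => by
    rw [precedes_tupleRun hw hcopy hq hbq, precedes_tupleRun hw (hw b j hj) hq hbq]
    simp only [hpred]
  have key : loanList b j (tupleRun U (w ++ t)) = tupleRun U (w ++ t) := by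
    refine eq_of_precedes_iff (count_loanList hs) fun p q hpq hp hq => ?_
    rw [isCopy_congr (count_loanList hs)] at hp hq
    have hp' := (isCopy_congr hc _).1 hp
    have hq' := (isCopy_congr hc _).1 hq
    by_cases hps : p = (b, j)
    · subst hps
      rw [precedes_loanList_left hs]
      exact hleft q hpq hq'
    · by_cases hqs : q = (b, j)
      · subst hqs
        rw [precedes_loanList_right hs hp hpq, precedes_iff_not hpq hp hq]
        exact not_congr (hleft p hpq.symm hp')
      · exact precedes_loanList_of_ne hs hp hq hpq hps hqs
  obtain ⟨t₁, h₁⟩ := tupleRun_append (U := U) w t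
  obtain ⟨t₂, h₂⟩ := loanList_append b j (tupleRun U w) t₁
  rw [h₁, h₂] at key
  exact (List.append_inj key (by simp [length_loanList])).1

theorem sum_count_eq_length {B : Type*} [Fintype B] [DecidableEq B] (w : List B) :
    ∑ b, w.count b = w.length := by
  simpa using Multiset.sum_count_eq_card (s := Finset.univ) (m := (w : Multiset B)) (by simp)

/-- In a prolonged word the copy `(b, lead (U b))` goes to the front group, ahead of every `(c, lead
(U c) + 1)`. If it missed the prefix, no letter `c` could occur there more than `lead (U c)` times,
and the prefix would be too short. -/
theorem lead_le_count_tupleRun (hU : ∀ b, 0 ∉ U b) (w : List (Fin m))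
    (hlen : ∑ b, lead (U b) ≤ w.length) (b : Fin m) :
    lead (U b) ≤ (tupleRun U w).count b := by
  by_contra! hlt
  obtain ⟨t, ht⟩ := exists_extension hU
  obtain ⟨hw, hlast⟩ := ht w
  obtain ⟨t₁, h₁⟩ := tupleRun_append (U := U) w t
  have hle : ∀ c, (tupleRun U w).count c ≤ lead (U c) := by
    intro c
    by_contra! hc
    have hcb : c ≠ b := by
      rintro rfl
      omega
    have htake : (tupleRun U (w ++ t)).take (tupleRun U w).length = tupleRun U w := by
      rw [h₁, List.take_left]
    have h2 := before_le_count_take (b := c) (c := b) (tupleRun U (w ++ t))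
      (tupleRun U w).length (lead (U c) + 1) (by rw [htake]; exact hc)
    rw [htake] at h2
    have hb : IsCopy (w ++ t) (b, lead (U b)) :=
      ⟨by simp only; omega, (Nat.le_succ _).trans (hlast b).2⟩
    have h3 : Precedes (tupleRun U (w ++ t)) (c, lead (U c) + 1) (b, lead (U b)) :=
      lt_of_le_of_lt h2 hlt
    rw [precedes_tupleRun hw (hlast c) hb hcb] at h3
    simp [root_eq_zero_iff] at h3
  have h4 : ∑ c, (tupleRun U w).count c < ∑ c, lead (U c) :=
    Finset.sum_lt_sum (fun c _ => hle c) ⟨b, Finset.mem_univ b, hlt⟩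
  rw [sum_count_eq_length, length_tupleRun] at h4
  omega

end Truncation

/-! ### Appending one letter -/

section Fibres

theorem run_append_singleton_of_ne {W : List (B × ℕ)} {u : List B}
    (h : ∀ s ∈ W, u.count s.1 + 1 ≠ s.2) (a : B) :
    run W (u ++ [a]) = run W u ++ [a] ∧ ∀ c, (run W u).count c = u.count c := by
  induction W with
  | nil => exact ⟨rfl, fun _ => rfl⟩
  | cons s W ih =>
    obtain ⟨h1, h2⟩ := ih fun s hs => h s (List.mem_cons_of_mem _ hs)
    have hs : (run W u).count s.1 + 1 ≠ s.2 := by rw [h2]; exact h s List.mem_cons_self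
    rw [run_cons, run_cons, h1, loanList_append_singleton_of_ne _ _ _ _ hs]
    exact ⟨rfl, fun c => by rw [(loanList_perm _ _ _ hs).count_eq, h2]⟩

/-- The rightmost operator meeting the critical count forgets the appended letter; the operators
before it in time keep all counts, and the later ones cannot recover the letter. -/
theorem run_append_singleton_of_eq {W : List (B × ℕ)} {u : List B}
    (h : ∃ s ∈ W, u.count s.1 + 1 = s.2) :
    ∃ c, ∀ a, run W (u ++ [a]) = run W u ++ [c] := by
  induction W with
  | nil => simp at h
  | cons s W ih =>
    by_cases hW : ∃ s ∈ W, u.count s.1 + 1 = s.2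
    · obtain ⟨c, hc⟩ := ih hW
      obtain ⟨t, ht⟩ := loanList_append s.1 s.2 (run W u) [c]
      have hlen := congrArg List.length ht
      rw [length_loanList, List.length_append, List.length_append, length_loanList] at hlen
      obtain ⟨d, rfl⟩ := List.length_eq_one_iff.mp (show t.length = 1 by simpa using hlen.symm)
      exact ⟨d, fun a => by rw [run_cons, run_cons, hc, ht]⟩
    · push Not at hW
      have hs : u.count s.1 + 1 = s.2 := by
        obtain ⟨s', hs', h'⟩ := h
        rcases List.mem_cons.1 hs' with rfl | hs'
        · exact h'
        · exact absurd h' (hW s' hs')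
      obtain ⟨c, hc⟩ := loanList_append_singleton_of_eq s.1 (run W u)
      refine ⟨c, fun a => ?_⟩
      obtain ⟨h1, h2⟩ := run_append_singleton_of_ne hW a
      rw [run_cons, run_cons, h1, ← hs, ← h2, hc]

theorem fixed_of_append {W : List (B × ℕ)} {u : List B} {a : B}
    (h : run W (u ++ [a]) = u ++ [a]) : run W u = u := by
  obtain ⟨t, ht⟩ := run_append_word W u [a]
  rw [h] at ht
  exact ((List.append_inj ht (by rw [length_run])).1).symm

/-- The image does not depend on the appended letter. Taking that letter to be `b` makes the
operator a rearrangement, so `u ++ [a]` has one more `b` than `u`. -/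
theorem eq_of_loanList_append_singleton {b a : B} {u : List B}
    (h : loanList b (u.count b + 1) (u ++ [a]) = u ++ [a]) : a = b := by
  obtain ⟨c, hc⟩ := loanList_append_singleton_of_eq b u
  rw [hc] at h
  obtain ⟨h1, h2⟩ := List.append_inj h (by rw [length_loanList])
  have h3 := hc b
  rw [h1, h2] at h3
  have h4 := (loanList_perm b (u ++ [b]) (u.count b + 1) (by simp)).count_eq b
  rw [h3] at h4
  simp only [List.count_append, List.count_singleton_self] at h4
  by_contra hab
  simp [hab] at h4

end Fibres

/-! ### Counting fixed words letter by letter -/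

section Counting

variable {m : ℕ}

/-- All words of length `k`, as lists. -/
def words (m : ℕ) : ℕ → Finset (List (Fin m))
  | 0 => {[]}
  | k + 1 => (words m k ×ˢ Finset.univ).image fun p => p.1 ++ [p.2]

theorem mem_words {k : ℕ} {w : List (Fin m)} : w ∈ words m k ↔ w.length = k := by
  induction k generalizing w with
  | zero => simp [words]
  | succ k ih =>
    simp only [words, Finset.mem_image, Finset.mem_product, Finset.mem_univ, and_true, ih,
      Prod.exists]
    constructor
    · rintro ⟨u, a, hu, rfl⟩
      simp [hu]
    · intro h
      have hne : w ≠ [] := by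
        rintro rfl
        simp at h
      exact ⟨w.dropLast, w.getLast hne, by simp [h], List.dropLast_append_getLast hne⟩

theorem sum_words_succ {M : Type*} [AddCommMonoid M] (k : ℕ) (f : List (Fin m) → M) :
    ∑ w ∈ words m (k + 1), f w = ∑ u ∈ words m k, ∑ a, f (u ++ [a]) := by
  rw [words, Finset.sum_image, Finset.sum_product]
  rintro ⟨u, a⟩ _ ⟨v, c⟩ _ h
  have := List.append_inj' h rfl
  simpa using this

/-- The number of words of length `k` fixed by `e_U`. -/
def fixedCount (U : Fin m → Finset ℕ) (k : ℕ) : ℕ :=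
  ((words m k).filter fun w => tupleRun U w = w).card

/-- The number of words of length `k` and content `n` fixed by `e_U`. -/
def fixedContentCount (U : Fin m → Finset ℕ) (k : ℕ) (n : Fin m → ℕ) : ℕ :=
  ((words m k).filter fun w => tupleRun U w = w ∧ ∀ b, w.count b = n b).card

variable {U : Fin m → Finset ℕ}

theorem tupleRun_fixed_append_of_ne {u : List (Fin m)} (hu : tupleRun U u = u)
    (h : ∀ b, u.count b + 1 ∉ U b) (a : Fin m) : tupleRun U (u ++ [a]) = u ++ [a] := by
  have := (run_append_singleton_of_ne (W := tupleList U (List.finRange m)) (u := u)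
    (fun s hs h' => h s.1 (by rw [h']; exact (mem_tupleList.1 hs).2)) a).1
  rw [tupleRun, this]
  exact congrArg (· ++ [a]) hu

theorem exists_tupleRun_fixed_append_iff {u : List (Fin m)} (hu : tupleRun U u = u) {b : Fin m}
    (h : u.count b + 1 ∈ U b) : ∃ c, ∀ a, tupleRun U (u ++ [a]) = u ++ [a] ↔ a = c := by
  obtain ⟨c, hc⟩ := run_append_singleton_of_eq (W := tupleList U (List.finRange m)) (u := u)
    ⟨(b, u.count b + 1), mem_tupleList.2 ⟨by simp, h⟩, rfl⟩
  refine ⟨c, fun a => ?_⟩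
  rw [tupleRun, hc]
  rw [tupleRun] at hu
  rw [hu, List.append_cancel_left_eq, List.cons.injEq]
  exact ⟨fun h => h.1.symm, fun h => ⟨h.symm, rfl⟩⟩

/-- Below this length some letter occurs fewer than `lead (U b)` times, so its next index lies in `U
b` and a fixed word has exactly one fixed extension. -/
theorem fixedCount_eq_one (k : ℕ) (hk : k ≤ ∑ b, lead (U b)) : fixedCount U k = 1 := by
  induction k with
  | zero =>
    have : tupleRun U [] = [] := List.length_eq_zero_iff.mp (length_tupleRun _)
    simp [fixedCount, words, Finset.filter_singleton, this]
  | succ k ih =>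
    refine Eq.trans ?_ (ih (by omega))
    rw [fixedCount, fixedCount, Finset.card_filter, Finset.card_filter, sum_words_succ]
    refine Finset.sum_congr rfl fun u hu => ?_
    by_cases hfix : tupleRun U u = u
    · have : ∃ b, u.count b < lead (U b) := by
        by_contra! h
        have := Finset.sum_le_sum fun b (_ : b ∈ Finset.univ) => h b
        rw [sum_count_eq_length, mem_words.1 hu] at this
        omega
      obtain ⟨b, hb⟩ := this
      obtain ⟨c, hc⟩ := exists_tupleRun_fixed_append_iff hfix (mem_of_le_lead (by omega) hb)
      simp [hc, hfix]
    · rw [if_neg hfix]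
      exact Finset.sum_eq_zero fun a _ => if_neg fun h => hfix (fixed_of_append h)

/-- The length bound puts every critical index `u.count b + 1 ∈ U b` above `lead (U b)`. Then
`∂_{b,j}` with this index fixes the word, which forces its last letter to be `b`. -/
theorem tupleRun_fixed_append_iff (hU : ∀ b, 0 ∉ U b) {u : List (Fin m)}
    (hlen : ∑ b, lead (U b) ≤ u.length) (a : Fin m) :
    tupleRun U (u ++ [a]) = u ++ [a] ↔
      tupleRun U u = u ∧ ∀ b, b ≠ a → u.count b + 1 ∉ U b := by
  have key : ∀ a, tupleRun U (u ++ [a]) = u ++ [a] → ∀ b, u.count b + 1 ∈ U b → a = b := by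
    intro a h b hb
    have hu := fixed_of_append h
    have hle := lead_le_count_tupleRun hU u hlen b
    rw [show tupleRun U u = u from hu] at hle
    have := loanList_tupleRun hU hb (by omega) (u ++ [a])
    rw [h] at this
    exact eq_of_loanList_append_singleton this
  constructor
  · exact fun h => ⟨fixed_of_append h, fun b hba hb => hba (key a h b hb).symm⟩
  · rintro ⟨hu, h⟩
    by_cases ha : u.count a + 1 ∈ U a
    · obtain ⟨c, hc⟩ := exists_tupleRun_fixed_append_iff hu ha
      have h1 := (hc c).2 rfl
      -- Some letter `c` gives a fixed extension, and `key` identifies it with the critical letter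
      -- `a`.
      rw [← key c h1 a ha]
      exact h1
    · refine tupleRun_fixed_append_of_ne hu (fun b => ?_) a
      by_cases hba : b = a
      · rwa [hba]
      · exact h b hba

theorem fixedContentCount_succ (hU : ∀ b, 0 ∉ U b) {k : ℕ} (hk : ∑ b, lead (U b) ≤ k)
    (n : Fin m → ℕ) :
    fixedContentCount U (k + 1) n = ∑ a, if 1 ≤ n a ∧ ∀ b, b ≠ a → n b + 1 ∉ U b then
      fixedContentCount U k (Function.update n a (n a - 1)) else 0 := by
  have h1 : ∀ u ∈ words m k, ∀ a : Fin m,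
      (tupleRun U (u ++ [a]) = u ++ [a] ∧ ∀ b, (u ++ [a]).count b = n b) ↔
        (1 ≤ n a ∧ ∀ b, b ≠ a → n b + 1 ∉ U b) ∧
          tupleRun U u = u ∧ ∀ b, u.count b = Function.update n a (n a - 1) b := by
    intro u hu a
    rw [tupleRun_fixed_append_iff hU (by rw [mem_words.1 hu]; exact hk)]
    have h2 : (∀ b, (u ++ [a]).count b = n b) ↔
        1 ≤ n a ∧ ∀ b, u.count b = Function.update n a (n a - 1) b := by
      constructor
      · intro h
        have ha := h a
        simp only [List.count_append, List.count_singleton_self] at ha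
        refine ⟨by omega, fun b => ?_⟩
        by_cases hba : b = a
        · subst hba
          simp
          omega
        · have := h b
          simp [Ne.symm hba] at this
          simpa [hba] using this
      · rintro ⟨h1, h⟩ b
        have := h b
        by_cases hba : b = a
        · subst hba
          simp at this ⊢
          omega
        · simpa [hba, Ne.symm hba] using this
    rw [h2]
    constructor
    · rintro ⟨⟨h3, h4⟩, h5, h6⟩
      refine ⟨⟨h5, fun b hb => ?_⟩, h3, h6⟩
      have := h4 b hb
      rw [h6 b, Function.update_of_ne hb] at this
      exact this
    · rintro ⟨⟨h5, h4⟩, h3, h6⟩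
      refine ⟨⟨h3, fun b hb => ?_⟩, h5, h6⟩
      rw [h6 b, Function.update_of_ne hb]
      exact h4 b hb
  simp only [fixedContentCount, Finset.card_filter]
  rw [sum_words_succ, Finset.sum_comm]
  refine Finset.sum_congr rfl fun a _ => ?_
  rw [Finset.sum_congr rfl fun u hu => if_congr (h1 u hu a) rfl rfl]
  by_cases h : 1 ≤ n a ∧ ∀ b, b ≠ a → n b + 1 ∉ U b
  · rw [if_pos h]
    exact Finset.sum_congr rfl fun u _ => if_congr (and_iff_right h) rfl rfl
  · rw [if_neg h]
    exact Finset.sum_eq_zero fun u _ => if_neg fun h' => h h'.1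

theorem multinomial_of_neg {v : Fin m → ℤ} {i : Fin m} (h : v i < 0) : multinomial v = 0 :=
  if_neg fun h' => (h' i).not_gt h

/-- Pascal's rule for multinomial coefficients. -/
theorem multinomial_eq_sum {v : Fin m → ℤ} (hv : v ≠ 0) :
    multinomial v = ∑ a, multinomial fun b => v b - if b = a then 1 else 0 := by
  by_cases hnn : ∀ i, 0 ≤ v i
  · lift v to Fin m → ℕ using hnn
    have hpos : 0 < ∑ i, v i := by
      by_contra! h
      apply hv
      ext i
      have := Finset.single_le_sum (f := v) (fun _ _ => Nat.zero_le _) (Finset.mem_univ i)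
      simp
      omega
    -- Clearing the denominator `∏ (v i)!` turns the term of `a` into `v a * (∑ v - 1)!`, including
    -- the case `v a = 0`; these add up to `(∑ v)!`.
    have h1 : ∀ a, (∏ i, (v i).factorial) *
        (multinomial fun b => (v b : ℤ) - if b = a then 1 else 0) =
        v a * (∑ i, v i - 1).factorial := by
      intro a
      by_cases ha : v a = 0
      · rw [multinomial_of_neg (i := a) (by simp [ha]), ha]
        simp
      · have h2 : ∀ b, (v b : ℤ) - (if b = a then 1 else 0) =
            (Function.update v a (v a - 1) b : ℕ) := by
          intro b
          by_cases hb : b = a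
          · subst hb
            simp
            omega
          · simp [hb]
        have h3 : ∑ i, Function.update v a (v a - 1) i = ∑ i, v i - 1 := by
          have h5 : ∑ x ∈ Finset.univ.erase a, Function.update v a (v a - 1) x =
              ∑ x ∈ Finset.univ.erase a, v x := Finset.sum_congr rfl fun x hx =>
            Function.update_of_ne (Finset.ne_of_mem_erase hx) _ v
          rw [← Finset.add_sum_erase _ _ (Finset.mem_univ a), h5,
            ← Finset.add_sum_erase _ (fun i => v i) (Finset.mem_univ a)]
          simp only [Function.update_self]
          omega
        have h4 : ∏ i, (v i).factorial =
            v a * ∏ i, (Function.update v a (v a - 1) i).factorial := by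
          rw [← Finset.mul_prod_erase _ _ (Finset.mem_univ a),
            ← Finset.mul_prod_erase (Finset.univ)
              (fun i => (Function.update v a (v a - 1) i).factorial) (Finset.mem_univ a)]
          rw [Finset.prod_congr rfl fun x hx => by
            rw [← Function.update_of_ne (Finset.ne_of_mem_erase hx) (v a - 1) v]]
          simp only [Function.update_self]
          rw [← mul_assoc, Nat.mul_factorial_pred ha]
        simp only [h2]
        rw [multinomial, if_pos (by simp), h4, mul_assoc, ← h3]
        simp only [Int.toNat_natCast]
        rw [Nat.multinomial_spec]
    have h5 : 0 < ∏ i, (v i).factorial := Finset.prod_pos fun i _ => Nat.factorial_pos _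
    apply Nat.eq_of_mul_eq_mul_left h5
    rw [Finset.mul_sum, Finset.sum_congr rfl fun a _ => h1 a, ← Finset.sum_mul,
      Nat.mul_factorial_pred hpos.ne', multinomial, if_pos (by simp)]
    simp only [Int.toNat_natCast]
    rw [Nat.multinomial_spec]
  · push Not at hnn
    obtain ⟨i, hi⟩ := hnn
    rw [multinomial_of_neg hi]
    symm
    refine Finset.sum_eq_zero fun a _ => multinomial_of_neg (i := i) ?_
    split_ifs <;> omega

end Counting

/-! ### The multinomial formula -/

section Formula

variable {m : ℕ} {U : Fin m → Finset ℕ}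

/-- The number of fixed words of content `n`, as predicted by the formula. -/
def contentFormula (U : Fin m → Finset ℕ) (n : Fin m → ℕ) : ℕ :=
  if (Finset.univ.filter fun i => n i + 1 ∈ U i).card ≤ 1 then
    multinomial fun i => (n i : ℤ) - (blockVector U n i : ℤ) else 0

theorem contentFormula_of_le_blockVector {n : Fin m → ℕ} {i : Fin m}
    (h : n i < blockVector U n i) : contentFormula U n = 0 := by
  rw [contentFormula, multinomial_of_neg (i := i) (by omega), ite_self]

theorem filter_le_add_one_of_le_lead {V : Finset ℕ} (hV : 0 ∉ V) {k : ℕ} (hk : k ≤ lead V)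
    {j : ℕ} (hj : j ≤ k ∨ j ≤ k + 1 ∧ k + 1 ∉ V) (hkj : k ≤ j) :
    V.filter (fun r => r ≤ j) = Finset.Icc 1 k := by
  ext r
  simp only [Finset.mem_filter, Finset.mem_Icc]
  constructor
  · rintro ⟨h1, h2⟩
    have h3 : r ≠ 0 := fun h => hV (h ▸ h1)
    rcases hj with hj | ⟨hj, hk1⟩
    · omega
    · have : r ≠ k + 1 := fun h => hk1 (h ▸ h1)
      omega
  · rintro ⟨h1, h2⟩
    exact ⟨mem_of_le_lead h1 (h2.trans hk), by omega⟩

/-- If `n b < lead (U b)`, then all of `1, …, n b + 1` lie in `U b`, so the block entry exceeds `n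
b` and the multinomial vanishes. At the threshold length only the content `lead` escapes this. -/
theorem contentFormula_sum_lead (hU : ∀ b, 0 ∉ U b) {n : Fin m → ℕ}
    (hn : ∑ i, n i = ∑ b, lead (U b)) :
    contentFormula U n = if ∀ b, n b = lead (U b) then 1 else 0 := by
  by_cases h : ∀ b, n b = lead (U b)
  · obtain rfl : n = fun b => lead (U b) := funext h
    have h1 : ∀ b, blockVector U (fun b => lead (U b)) b = lead (U b) := fun b => by
      rw [blockVector, filter_le_add_one_of_le_lead (hU b) (k := lead (U b)) le_rfl
        (Or.inr ⟨le_rfl, lead_add_one_notMem _⟩) (by simp)]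
      simp
    have h2 : (fun i => ((lead (U i) : ℕ) : ℤ) - (blockVector U (fun b => lead (U b)) i : ℤ)) =
        fun _ => 0 := funext fun i => by rw [h1, sub_self]
    rw [contentFormula, h2]
    simp [lead_add_one_notMem, multinomial, Nat.multinomial]
  · rw [if_neg h]
    have : ∃ b, n b < lead (U b) := by
      by_contra! h'
      apply h
      have := (Finset.sum_eq_sum_iff_of_le (s := Finset.univ) fun i _ => h' i).1 hn.symm
      exact fun b => (this b (Finset.mem_univ b)).symm
    obtain ⟨b, hb⟩ := this
    refine contentFormula_of_le_blockVector (i := b) ?_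
    rw [blockVector, filter_le_add_one_of_le_lead (hU b) (k := n b + 1) hb (Or.inl le_rfl) le_rfl]
    simp

theorem blockVector_update (n : Fin m → ℕ) (a b : Fin m) (ha : 1 ≤ n a) :
    (blockVector U (Function.update n a (n a - 1)) b : ℤ) =
      blockVector U n b - if b = a ∧ n a + 1 ∈ U a then 1 else 0 := by
  by_cases hba : b = a
  · subst hba
    simp only [blockVector, Function.update_self, Nat.sub_add_cancel ha, true_and]
    have h1 : (U b).filter (fun r => r ≤ n b + 1) = if n b + 1 ∈ U b then
        insert (n b + 1) ((U b).filter fun r => r ≤ n b) else (U b).filter fun r => r ≤ n b := by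
      split_ifs with h
      · ext r
        simp only [Finset.mem_filter, Finset.mem_insert]
        constructor
        · rintro ⟨h1, h2⟩
          by_cases h3 : r = n b + 1
          · exact Or.inl h3
          · exact Or.inr ⟨h1, by omega⟩
        · rintro (rfl | ⟨h1, h2⟩)
          · exact ⟨h, le_rfl⟩
          · exact ⟨h1, by omega⟩
      · ext r
        simp only [Finset.mem_filter, and_congr_right_iff]
        intro hr
        have : r ≠ n b + 1 := fun h' => h (h' ▸ hr)
        omega
    rw [h1]
    split_ifs
    · rw [Finset.card_insert_of_notMem (by simp)]
      simp
    · simp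
  · simp [blockVector, hba]

/-- Without a critical letter this is Pascal's rule. With a critical letter `c` only `a = c` can
contribute, and there `n c` and the block entry drop together, leaving their difference unchanged.
-/
theorem contentFormula_succ (hU : ∀ b, 0 ∉ U b) {n : Fin m → ℕ}
    (hn : ∑ b, lead (U b) < ∑ i, n i) :
    contentFormula U n = ∑ a, if 1 ≤ n a ∧ ∀ b, b ≠ a → n b + 1 ∉ U b then
      contentFormula U (Function.update n a (n a - 1)) else 0 := by
  have h1 : ∀ a, (1 ≤ n a ∧ ∀ b, b ≠ a → n b + 1 ∉ U b) →
      contentFormula U (Function.update n a (n a - 1)) =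
        multinomial fun b => ((n b : ℤ) - blockVector U n b) -
          if b = a ∧ n a + 1 ∉ U a then 1 else 0 := by
    rintro a ⟨ha, h⟩
    rw [contentFormula, if_pos]
    · congr 1
      funext b
      rw [blockVector_update n a b ha]
      by_cases hba : b = a
      · subst hba
        by_cases hb : n b + 1 ∈ U b <;> simp [hb] <;> omega
      · simp [hba]
    · rw [Finset.card_le_one]
      have : ∀ b, Function.update n a (n a - 1) b + 1 ∈ U b → b = a := fun b hb => by
        by_contra hba
        rw [Function.update_of_ne hba] at hb
        exact h b hba hb
      intro b hb c hc
      rw [this b (by simpa using hb), this c (by simpa using hc)]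
  rw [Finset.sum_congr rfl fun a _ => if_ctx_congr Iff.rfl (h1 a) fun _ => rfl]
  by_cases h0 : ∀ b, n b + 1 ∉ U b
  · have hv : (fun b => (n b : ℤ) - blockVector U n b) ≠ 0 := by
      obtain ⟨b, -, hb⟩ := Finset.exists_lt_of_sum_lt hn
      intro h
      have h2 := congrFun h b
      have h3 : (U b).filter (fun r => r ≤ n b + 1) ⊆
          (Finset.Icc 1 (n b)).erase (lead (U b) + 1) := by
        intro r hr
        rw [Finset.mem_filter] at hr
        have h4 : r ≠ 0 := fun h => hU b (h ▸ hr.1)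
        have h5 : r ≠ n b + 1 := fun h => h0 b (h ▸ hr.1)
        have h6 : r ≠ lead (U b) + 1 := fun h => lead_add_one_notMem (U b) (h ▸ hr.1)
        simp only [Finset.mem_erase, Finset.mem_Icc]
        omega
      have h4 := Finset.card_le_card h3
      rw [Finset.card_erase_of_mem (by simp; omega), Nat.card_Icc] at h4
      simp only [Pi.zero_apply, blockVector] at h2
      omega
    rw [contentFormula, if_pos (by simp [h0]), multinomial_eq_sum hv]
    refine Finset.sum_congr rfl fun a _ => ?_
    by_cases ha : 1 ≤ n a
    · simp [ha, h0]
    · rw [if_neg (by tauto)]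
      exact multinomial_of_neg (i := a) (by simp; omega)
  · push Not at h0
    obtain ⟨c, hc⟩ := h0
    rw [Finset.sum_eq_single c]
    · by_cases hcn : 1 ≤ n c
      · have h2 : (Finset.univ.filter fun i => n i + 1 ∈ U i).card ≤ 1 ↔
            ∀ b, b ≠ c → n b + 1 ∉ U b := by
          rw [Finset.card_le_one]
          constructor
          · exact fun h b hb hb' => hb (h b (by simpa using hb') c (by simpa using hc))
          · intro h
            have : ∀ b, n b + 1 ∈ U b → b = c := fun b hb => by
              by_contra hbc
              exact h b hbc hb
            intro a ha b hb
            rw [this a (by simpa using ha), this b (by simpa using hb)]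
        rw [contentFormula]
        refine if_congr ?_ ?_ rfl
        · rw [h2]
          exact ⟨fun h => ⟨hcn, h⟩, fun h => h.2⟩
        · simp [hc]
      · rw [if_neg (by tauto)]
        refine contentFormula_of_le_blockVector (i := c) ?_
        have h2 : n c = 0 := by omega
        rw [h2, blockVector, Finset.card_pos]
        exact ⟨n c + 1, by simpa using hc⟩
    · exact fun a _ hac => if_neg fun h => h.2 c hac.symm hc
    · simp

theorem fixedContentCount_eq (hU : ∀ b, 0 ∉ U b) {k : ℕ} (hk : ∑ b, lead (U b) ≤ k)
    (n : Fin m → ℕ) (hn : ∑ i, n i = k) : fixedContentCount U k n = contentFormula U n := by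
  induction k, hk using Nat.le_induction generalizing n with
  | base =>
    rw [contentFormula_sum_lead hU hn]
    obtain ⟨w, hw⟩ := Finset.card_eq_one.1 (fixedCount_eq_one (U := U) _ le_rfl)
    have hmem := Finset.mem_singleton_self w
    rw [← hw, Finset.mem_filter, mem_words] at hmem
    have hcount : ∀ b, w.count b = lead (U b) := by
      have h1 : ∀ b, lead (U b) ≤ w.count b := fun b => by
        have := lead_le_count_tupleRun hU w hmem.1.ge b
        rwa [hmem.2] at this
      have h2 := (Finset.sum_eq_sum_iff_of_le (s := Finset.univ) fun b _ => h1 b).1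
        (by rw [sum_count_eq_length, hmem.1])
      exact fun b => (h2 b (Finset.mem_univ b)).symm
    rw [fixedContentCount, ← Finset.filter_filter, hw, Finset.filter_singleton]
    simp only [hcount, eq_comm (a := lead _)]
    split_ifs <;> rfl
  | succ k hk ih =>
    rw [fixedContentCount_succ hU hk, contentFormula_succ hU (by omega)]
    refine Finset.sum_congr rfl fun a _ => ?_
    refine if_ctx_congr Iff.rfl (fun h => ih _ ?_) fun _ => rfl
    have h1 := Finset.sum_update_of_mem (Finset.mem_univ a) n (n a - 1)
    have h2 := Finset.add_sum_erase Finset.univ n (Finset.mem_univ a)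
    rw [← Finset.erase_eq] at h1
    have := h.1
    omega

theorem fixedCount_eq_sum (hU : ∀ b, 0 ∉ U b) {L : ℕ} (hL : ∑ b, lead (U b) ≤ L) :
    fixedCount U L = ∑ n ∈ admissibleContents m L U,
      multinomial fun i => (n i : ℤ) - (blockVector U n i : ℤ) := by
  have h1 : fixedCount U L = ∑ n ∈ Finset.piAntidiag Finset.univ L, fixedContentCount U L n := by
    rw [fixedCount, Finset.card_eq_sum_card_fiberwise (f := fun w b => w.count b)
      (t := Finset.piAntidiag Finset.univ L)]
    · refine Finset.sum_congr rfl fun n _ => ?_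
      rw [fixedContentCount, Finset.filter_filter]
      simp only [funext_iff]
    · intro w hw
      rw [Finset.mem_coe, Finset.mem_filter, mem_words] at hw
      rw [Finset.mem_coe, Finset.mem_piAntidiag]
      exact ⟨by rw [sum_count_eq_length, hw.1], by simp⟩
  rw [h1, admissibleContents, Finset.sum_filter]
  refine Finset.sum_congr rfl fun n hn => ?_
  rw [fixedContentCount_eq hU hL n (Finset.mem_piAntidiag.1 hn).1]
  -- The condition on `1 ∈ U i` in `admissibleContents` only discards zero terms: if `n i = 0`, the
  -- block entry is already positive.
  by_cases h2 : ∀ i, 1 ∈ U i → n i ≠ 0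
  · rw [contentFormula]
    exact if_congr ⟨fun h => ⟨h2, h⟩, fun h => h.2⟩ rfl rfl
  · rw [if_neg fun h => h2 h.1]
    push Not at h2
    obtain ⟨i, hi, hn0⟩ := h2
    refine contentFormula_of_le_blockVector (i := i) ?_
    rw [hn0, blockVector, Finset.card_pos]
    exact ⟨1, by simpa using hi⟩

theorem sInf_eq_lead_add_one {V : Finset ℕ} {L : ℕ} (hV : V ⊂ Finset.Icc 1 L) :
    sInf {r : ℕ | r ∈ Finset.Icc 1 L \ V} = lead V + 1 := by
  obtain ⟨h1, h2⟩ := Finset.ssubset_iff_subset_ne.1 hV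
  obtain ⟨r, hr, hrV⟩ := Finset.exists_of_ssubset hV
  have hle : ∀ r, r ∈ Finset.Icc 1 L → r ∉ V → lead V + 1 ≤ r := fun r hr hrV => by
    by_contra! h
    exact hrV (mem_of_le_lead (Finset.mem_Icc.1 hr).1 (by omega))
  apply le_antisymm
  · apply Nat.sInf_le
    have := hle r hr hrV
    have := (Finset.mem_Icc.1 hr).2
    simp only [Set.mem_ofPred_eq, Finset.mem_sdiff, Finset.mem_Icc]
    exact ⟨⟨by omega, by omega⟩, lead_add_one_notMem V⟩
  · apply le_csInf ⟨r, by simpa using ⟨Finset.mem_Icc.1 hr, hrV⟩⟩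
    intro s hs
    rw [Set.mem_ofPred_eq, Finset.mem_sdiff] at hs
    exact hle s hs.1 hs.2

theorem fixedCount_eq_fixedPointFormula {L : ℕ} (hU : ∀ b, U b ⊆ Finset.Icc 1 L) :
    fixedCount U L = fixedPointFormula m L U := by
  have hU0 : ∀ b, 0 ∉ U b := fun b h => by simpa using hU b h
  by_cases hproper : ∀ i, U i ⊂ Finset.Icc 1 L
  · have hsum : ∑ i, sInf {r : ℕ | r ∈ Finset.Icc 1 L \ U i} = ∑ i, lead (U i) + m := by
      rw [Finset.sum_congr rfl fun i _ => sInf_eq_lead_add_one (hproper i),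
        Finset.sum_add_distrib]
      simp
    by_cases hlt : ∑ i, lead (U i) < L
    · rw [fixedPointFormula, if_pos ⟨hproper, by omega⟩, fixedCount_eq_sum hU0 hlt.le]
    · rw [fixedPointFormula, if_neg (fun h => by omega), fixedCount_eq_one _ (by omega)]
  · rw [fixedPointFormula, if_neg fun h => hproper h.1, fixedCount_eq_one]
    push Not at hproper
    obtain ⟨i, hi⟩ := hproper
    have hiU : U i = Finset.Icc 1 L := by
      by_contra hne
      exact hi (Finset.ssubset_iff_subset_ne.2 ⟨hU i, hne⟩)
    have : L ≤ lead (U i) := by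
      by_contra! h
      exact lead_add_one_notMem (U i) (by rw [hiU] at h ⊢; simp; omega)
    exact this.trans (Finset.single_le_sum (f := fun b => lead (U b))
      (fun _ _ => Nat.zero_le _) (Finset.mem_univ i))

end Formula

/-! ### Fixed points of arbitrary products -/

section WordMaps

variable {m L : ℕ}

/-- The composition of a sequence of operators as a map on words of length `L`. -/
def runWord (L : ℕ) (W : List (Fin m × ℕ)) (w : Word m L) : Word m L :=
  ⟨run W w.1, (length_run W w.1).trans w.2⟩

theorem runWord_append (V W : List (Fin m × ℕ)) (w : Word m L) :
    runWord L (V ++ W) w = runWord L V (runWord L W w) :=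
  Subtype.ext (run_append V W w.1)

theorem tupleMap_eq_runWord (U : Fin m → Finset ℕ) :
    tupleMap m L U = runWord L (tupleList U (List.finRange m)) := by
  have key : ∀ W : List (Fin m × ℕ), (W.map fun s => (loan s.1 s.2 : Word m L → Word m L)).foldr
      (fun f g => f ∘ g) id = runWord L W := by
    intro W
    induction W with
    | nil => rfl
    | cons s W ih =>
      rw [List.map_cons, List.foldr_cons, ih]
      rfl
  rw [← key, tupleMap, tupleList, List.map_flatMap]
  simp [List.map_map, Function.comp_def]

theorem tupleMap_val (U : Fin m → Finset ℕ) (w : Word m L) :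
    (tupleMap m L U w).1 = tupleRun U w.1 := by
  rw [tupleMap_eq_runWord]
  rfl

theorem tupleMap_tupleMap {U : Fin m → Finset ℕ} (hU : ∀ b, 0 ∉ U b) (w : Word m L) :
    tupleMap m L U (tupleMap m L U w) = tupleMap m L U w :=
  Subtype.ext (by rw [tupleMap_val, tupleMap_val, tupleRun_tupleRun hU])

theorem imageCount_eq_card_fixed {U : Fin m → Finset ℕ} (hU : ∀ b, 0 ∉ U b) :
    imageCount m L U = (Finset.univ.filter fun w : Word m L => tupleMap m L U w = w).card := by
  rw [imageCount]
  congr 1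
  ext w
  simp only [Finset.mem_image, Finset.mem_univ, true_and, Finset.mem_filter]
  exact ⟨fun ⟨v, hv⟩ => by rw [← hv, tupleMap_tupleMap hU], fun h => ⟨w, h⟩⟩

theorem imageCount_eq_fixedCount {U : Fin m → Finset ℕ} (hU : ∀ b, 0 ∉ U b) :
    imageCount m L U = fixedCount U L := by
  rw [imageCount_eq_card_fixed hU, fixedCount]
  refine Finset.card_bij (fun w _ => w.1) ?_ (fun v _ w _ h => Subtype.ext h) ?_
  · intro w hw
    rw [Finset.mem_filter] at hw ⊢
    exact ⟨mem_words.2 w.2, by rw [← tupleMap_val, hw.2]⟩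
  · intro w hw
    rw [Finset.mem_filter, mem_words] at hw
    refine ⟨⟨w, hw.1⟩, ?_, rfl⟩
    exact Finset.mem_filter.2 ⟨Finset.mem_univ _, Subtype.ext ((tupleMap_val _ _).trans hw.2)⟩

/-- The sets of indices `j` with which the letters occur in a sequence of operators. -/
def support (W : List (Fin m × ℕ)) (b : Fin m) : Finset ℕ :=
  (W.filter fun s => s.1 = b).map Prod.snd |>.toFinset

theorem mem_support {W : List (Fin m × ℕ)} {b : Fin m} {j : ℕ} :
    j ∈ support W b ↔ (b, j) ∈ W := by
  simp [support]

theorem card_image_le_of_comp_eq {α : Type*} [Fintype α] [DecidableEq α] {f g : α → α}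
    (h : ∀ x, f (g x) = f x) : (Finset.univ.image f).card ≤ (Finset.univ.image g).card := by
  have : Finset.univ.image f = (Finset.univ.image g).image f := by
    rw [Finset.image_image]
    exact Finset.image_congr fun x _ => (h x).symm
  rw [this]
  exact Finset.card_image_le

/-- The number of fixed points of a product of operators only depends on its set of factors. -/
theorem card_fixed_runWord (W : List (Fin m × ℕ)) (hW : ∀ s ∈ W, 1 ≤ s.2) :
    (Finset.univ.filter fun w : Word m L => runWord L W w = w).card =
      imageCount m L (support W) := by
  have hU : ∀ b, 0 ∉ support W b := fun b h => by simpa using hW _ (mem_support.1 h)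
  obtain ⟨N, hN⟩ := exists_iterate_run_loanList W hW L
  have hval : ∀ n (w : Word m L), ((runWord L W)^[n] w).1 = (run W)^[n] w.1 := by
    intro n
    induction n with
    | zero => exact fun _ => rfl
    | succ n ih =>
      intro w
      rw [Function.iterate_succ_apply, Function.iterate_succ_apply, ih]
      rfl
  have habs : ∀ V : List (Fin m × ℕ), (∀ s ∈ V, s ∈ W) → ∀ w : Word m L,
      (runWord L W)^[N] (runWord L V w) = (runWord L W)^[N] w := by
    intro V hV w
    induction V with
    | nil => rfl
    | cons s V ih =>
      rw [← ih fun s hs => hV s (List.mem_cons_of_mem _ hs)]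
      refine Subtype.ext ?_
      rw [hval, hval]
      exact hN s (hV s List.mem_cons_self) _ (runWord L V w).2
  have habs' : ∀ V : List (Fin m × ℕ), (∀ s ∈ V, s ∈ W) → ∀ w : Word m L,
      tupleMap m L (support W) (runWord L V w) = tupleMap m L (support W) w := by
    intro V hV w
    induction V with
    | nil => rfl
    | cons s V ih =>
      rw [← ih fun s hs => hV s (List.mem_cons_of_mem _ hs)]
      refine Subtype.ext ?_
      rw [tupleMap_val, tupleMap_val]
      exact tupleRun_loanList hU (mem_support.2 (hV s List.mem_cons_self)) _
  -- Absorbing all of `W` gives equality of the `N`-th and `(N+1)`-st powers, so the image of the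
  -- `N`-th power consists of fixed points.
  have hfix : (Finset.univ.filter fun w : Word m L => runWord L W w = w) =
      Finset.univ.image (runWord L W)^[N] := by
    ext w
    simp only [Finset.mem_image, Finset.mem_univ, true_and, Finset.mem_filter]
    constructor
    · exact fun h => ⟨w, Function.iterate_fixed h N⟩
    · rintro ⟨v, rfl⟩
      rw [← Function.iterate_succ_apply' (runWord L W), Function.iterate_succ_apply, habs W fun s hs => hs]
  rw [hfix, imageCount]
  -- The `N`-th power of `W` and `e_U` absorb each other on the right, so each image is at most as
  -- large as the other.
  apply le_antisymm
  · refine card_image_le_of_comp_eq fun w => ?_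
    rw [tupleMap_eq_runWord]
    exact habs _ (fun s hs => mem_support.1 (mem_tupleList.1 hs).2) w
  · refine card_image_le_of_comp_eq fun w => ?_
    generalize N = n
    induction n generalizing w with
    | zero => rfl
    | succ n ih => rw [Function.iterate_succ_apply, ih, habs' W fun s hs => hs]

end WordMaps

/-! ### Eigenvalues from traces of powers -/

section Trace

open Polynomial

variable {n K : Type*} [Fintype n] [DecidableEq n] [Field K] [IsAlgClosed K]

theorem card_roots_charpoly (A : Matrix n n K) : A.charpoly.roots.card = Fintype.card n := by
  rw [← (IsAlgClosed.splits A.charpoly).natDegree_eq_card_roots, A.charpoly_natDegree_eq_dim]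

/-- Both sides are multiplicative in `Q`, and `Q` splits, so constants and linear factors suffice; a
linear factor is a value of the characteristic polynomial up to sign. -/
theorem det_aeval_eq_prod_roots (A : Matrix n n K) (Q : K[X]) :
    (aeval A Q).det = (A.charpoly.roots.map Q.eval).prod := by
  have hC : ∀ c : K, (aeval A (C c)).det = (A.charpoly.roots.map (C c).eval).prod := by
    intro c
    simp [Algebra.algebraMap_eq_smul_one, card_roots_charpoly]
  have hX : ∀ a : K, (aeval A (X - C a)).det = (A.charpoly.roots.map (X - C a).eval).prod := by
    intro a
    have h1 : A.charpoly.eval a = (A.charpoly.roots.map (a - ·)).prod :=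
      (IsAlgClosed.splits A.charpoly).eval_eq_prod_roots_of_monic A.charpoly_monic a
    rw [Matrix.eval_charpoly] at h1
    have h2 : aeval A (X - C a) = -(Matrix.scalar n a - A) := by
      simp [Matrix.algebraMap_eq_diagonal, Pi.algebraMap_def]
    have h3 : A.charpoly.roots.map (X - C a).eval =
        (A.charpoly.roots.map (a - ·)).map Neg.neg := by
      simp
    rw [h2, Matrix.det_neg, h1, h3, Multiset.prod_map_neg, Multiset.card_map, card_roots_charpoly]
  have hmul : ∀ P Q : K[X], (aeval A P).det = (A.charpoly.roots.map P.eval).prod →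
      (aeval A Q).det = (A.charpoly.roots.map Q.eval).prod →
      (aeval A (P * Q)).det = (A.charpoly.roots.map (P * Q).eval).prod := by
    intro P Q hP hQ
    rw [map_mul, Matrix.det_mul, hP, hQ, ← Multiset.prod_map_mul]
    simp
  rw [(IsAlgClosed.splits Q).eq_prod_roots]
  refine hmul _ _ (hC _) ?_
  induction Q.roots using Multiset.induction_on with
  | empty => simp
  | cons a s ih =>
    rw [Multiset.map_cons, Multiset.prod_cons]
    exact hmul _ _ (hX a) ih

theorem charpoly_aeval_eq_prod (A : Matrix n n K) (P : K[X]) :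
    (aeval A P).charpoly = ((A.charpoly.roots.map P.eval).map fun a => X - C a).prod := by
  refine Polynomial.funext fun y => ?_
  have h : Matrix.scalar n y - aeval A P = aeval A (C y - P) := by
    simp [Matrix.algebraMap_eq_diagonal, Pi.algebraMap_def]
  rw [Matrix.eval_charpoly, h, det_aeval_eq_prod_roots, Polynomial.eval_multiset_prod]
  simp

theorem trace_aeval_eq_sum_roots (A : Matrix n n K) (P : K[X]) :
    (aeval A P).trace = (A.charpoly.roots.map P.eval).sum := by
  rw [Matrix.trace_eq_sum_roots_charpoly, charpoly_aeval_eq_prod,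
    Polynomial.roots_multiset_prod_X_sub_C]

/-- If the traces of the powers of a matrix are the power sums of a signed family of numbers, then
this family is that of the eigenvalues. -/
theorem count_roots_charpoly_of_trace_pow [DecidableEq K] {ι : Type*} (s : Finset ι)
    (A : Matrix n n K) (c : ι → K) (lam : ι → K) (h : ∀ k : ℕ, (A ^ k).trace = ∑ i ∈ s, c i * lam i ^ k) (μ : K) :
    (A.charpoly.roots.count μ : K) = ∑ i ∈ s with lam i = μ, c i := by
  have h1 : ∀ P : K[X], (aeval A P).trace = ∑ i ∈ s, c i * P.eval (lam i) := by
    intro P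
    induction P using Polynomial.induction_on' with
    | add P Q hP hQ => simp [hP, hQ, mul_add, Finset.sum_add_distrib]
    | monomial k a =>
      rw [aeval_monomial, ← Algebra.smul_def, Matrix.trace_smul, h, Finset.smul_sum]
      refine Finset.sum_congr rfl fun i _ => ?_
      simp only [eval_monomial, smul_eq_mul]
      ring
  let E : Finset K := (A.charpoly.roots.toFinset ∪ s.image lam).erase μ
  -- A Lagrange polynomial, equal to 1 at `μ` and 0 at every other eigenvalue or `lam i`; the trace
  -- of `P(A)` isolates the multiplicity of `μ`.
  let P : K[X] := ∏ ν ∈ E, (C (μ - ν)⁻¹ * (X - C ν))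
  have hPμ : P.eval μ = 1 := by
    rw [eval_prod]
    refine Finset.prod_eq_one fun ν hν => ?_
    have : μ - ν ≠ 0 := sub_ne_zero.2 (Finset.ne_of_mem_erase hν).symm
    simp [this]
  have hP : ∀ ν ∈ A.charpoly.roots.toFinset ∪ s.image lam, P.eval ν = if ν = μ then 1 else 0 := by
    intro ν hν
    split_ifs with h
    · rw [h, hPμ]
    · rw [eval_prod]
      exact Finset.prod_eq_zero (Finset.mem_erase.2 ⟨h, hν⟩) (by simp)
  have h2 := h1 P
  rw [trace_aeval_eq_sum_roots] at h2
  rw [Multiset.map_congr rfl fun ν hν => hP ν (by simp at hν ⊢; exact Or.inl hν),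
    Finset.sum_congr rfl fun i hi => by
      rw [hP (lam i) (Finset.mem_union_right _ (Finset.mem_image_of_mem _ hi))]] at h2
  rw [Finset.sum_filter]
  simp only [mul_ite, mul_one, mul_zero] at h2
  rw [← h2]
  induction A.charpoly.roots using Multiset.induction_on with
  | empty => simp
  | cons a s ih =>
    rw [Multiset.count_cons, Multiset.map_cons, Multiset.sum_cons, ← ih]
    by_cases hb : a = μ
    · simp [hb, add_comm]
    · simp [hb, Ne.symm hb]

end Trace

/-! ### Möbius inversion for the multiplicities -/

section Moebius

theorem sum_Icc_neg_one_pow {S V : Finset ℕ} (h : S ⊆ V) :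
    ∑ X ∈ Finset.Icc S V, (-1 : ℤ) ^ (X.card - S.card) = if S = V then 1 else 0 := by
  have h1 : ∑ X ∈ Finset.Icc S V, (-1 : ℤ) ^ (X.card - S.card) =
      ∑ Y ∈ (V \ S).powerset, (-1 : ℤ) ^ Y.card := by
    refine Finset.sum_nbij' (fun X => X \ S) (fun Y => Y ∪ S) ?_ ?_ ?_ ?_ ?_
    · intro X hX
      rw [Finset.mem_Icc] at hX
      exact Finset.mem_powerset.2 (Finset.sdiff_subset_sdiff hX.2 subset_rfl)
    · intro Y hY
      rw [Finset.mem_powerset] at hY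
      exact Finset.mem_Icc.2 ⟨Finset.subset_union_right,
        Finset.union_subset (hY.trans Finset.sdiff_subset) h⟩
    · intro X hX
      exact Finset.sdiff_union_of_subset (Finset.mem_Icc.1 hX).1
    · intro Y hY
      rw [Finset.mem_powerset] at hY
      rw [Finset.union_sdiff_right]
      exact Finset.sdiff_eq_self_of_disjoint (Finset.disjoint_of_subset_left hY
        Finset.sdiff_disjoint)
    · intro X hX
      rw [Finset.card_sdiff_of_subset (Finset.mem_Icc.1 hX).1]
  rw [h1, Finset.sum_powerset_neg_one_pow_card]
  refine if_congr ?_ rfl rfl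
  rw [Finset.sdiff_eq_empty_iff_subset]
  exact ⟨fun h' => h.antisymm h', fun h' => h'.ge⟩

theorem sum_Icc_neg_one_pow' {S V : Finset ℕ} (h : S ⊆ V) :
    ∑ X ∈ Finset.Icc S V, (-1 : ℤ) ^ (V.card - X.card) = if S = V then 1 else 0 := by
  have h1 : ∀ X ∈ Finset.Icc S V, (-1 : ℤ) ^ (V.card - X.card) =
      (-1) ^ (V.card - S.card) * (-1) ^ (X.card - S.card) := by
    intro X hX
    rw [Finset.mem_Icc] at hX
    have h2 := Finset.card_le_card hX.1
    have h3 := Finset.card_le_card hX.2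
    have h4 : V.card - S.card + (X.card - S.card) =
        (V.card - X.card) + 2 * (X.card - S.card) := by omega
    rw [← pow_add, h4, pow_add, pow_mul]
    simp
  rw [Finset.sum_congr rfl h1, ← Finset.mul_sum, sum_Icc_neg_one_pow h]
  split_ifs with h2
  · simp [h2]
  · simp

variable {m L : ℕ}

theorem neg_one_pow_sum_sub {X V : Fin m → Finset ℕ} (h : ∀ i, X i ⊆ V i) :
    (-1 : ℤ) ^ (∑ i, (V i).card - ∑ i, (X i).card) =
      ∏ i, (-1 : ℤ) ^ ((V i).card - (X i).card) := by
  rw [Finset.prod_pow_eq_pow_sum,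
    Finset.sum_tsub_distrib _ fun i _ => Finset.card_le_card (h i)]

theorem mem_subsetTuples {X : Fin m → Finset ℕ} :
    X ∈ subsetTuples m L ↔ ∀ i, X i ⊆ Finset.Icc 1 L := by
  simp [subsetTuples]

theorem mem_properSubsetTuples {X : Fin m → Finset ℕ} :
    X ∈ properSubsetTuples m L ↔ ∀ i, X i ⊂ Finset.Icc 1 L := by
  simp [properSubsetTuples]

theorem piFinset_Icc {S V : Fin m → Finset ℕ} :
    (Fintype.piFinset fun i => Finset.Icc (S i) (V i)) = Finset.Icc S V := by
  ext X
  simp [Pi.le_def, forall_and]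

theorem prod_ite_eq {S V : Fin m → Finset ℕ} :
    (∏ i, if S i = V i then (1 : ℤ) else 0) = if S = V then 1 else 0 := by
  rw [Finset.prod_ite_zero]
  simp [funext_iff]

/-- Möbius inversion on the lattice of tuples of subsets. -/
theorem sum_multiplicity {S : Fin m → Finset ℕ} (hS : S ∈ subsetTuples m L) :
    ∑ X ∈ subsetTuples m L with ∀ i, S i ⊆ X i, multiplicity m L X = imageCount m L S := by
  simp only [multiplicity]
  -- For fixed `V` the signs are summed over the interval `[S, V]`, which is a product over letters;
  -- each factor vanishes unless `S i = V i`.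
  rw [Finset.sum_comm' (t' := (subsetTuples m L).filter fun V => ∀ i, S i ⊆ V i)
    (s' := fun V => Finset.Icc S V)]
  · rw [Finset.sum_eq_single S]
    · simp
    · intro V hV hVS
      rw [← Finset.sum_mul]
      have hSV := (Finset.mem_filter.1 hV).2
      rw [Finset.sum_congr rfl fun X hX => neg_one_pow_sum_sub (Finset.mem_Icc.1 hX).2,
        ← piFinset_Icc, ← Finset.prod_univ_sum (fun i => Finset.Icc (S i) (V i))
          (fun i X => (-1 : ℤ) ^ ((V i).card - X.card)),
        Finset.prod_congr rfl fun i _ => sum_Icc_neg_one_pow' (hSV i), prod_ite_eq,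
        if_neg (Ne.symm hVS), zero_mul]
    · intro h
      exact absurd (Finset.mem_filter.2 ⟨hS, fun _ => subset_rfl⟩) h
  · intro X V
    simp only [Finset.mem_filter, mem_subsetTuples, Finset.mem_Icc, Pi.le_def]
    constructor
    · rintro ⟨⟨h1, h2⟩, h3, h4⟩
      exact ⟨⟨h2, h4⟩, h3, fun i => (h2 i).trans (h4 i)⟩
    · rintro ⟨⟨h2, h4⟩, h3, h5⟩
      exact ⟨⟨fun i => (h4 i).trans (h3 i), h2⟩, h3, h4⟩

theorem imageCount_eq_fixedPointFormula {U : Fin m → Finset ℕ} (hU : U ∈ subsetTuples m L) :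
    imageCount m L U = fixedPointFormula m L U := by
  rw [mem_subsetTuples] at hU
  rw [imageCount_eq_fixedCount fun b h => by simpa using hU b h,
    fixedCount_eq_fixedPointFormula hU]

/-- One coordinate of `X` is all of `[L]`, hence so is that of every larger tuple, and all image
counts equal 1. What remains is a bare alternating sum over an interval. -/
theorem multiplicity_of_notMem {X : Fin m → Finset ℕ} (hX : X ∈ subsetTuples m L)
    (hX' : X ∉ properSubsetTuples m L) :
    multiplicity m L X = if X = fun _ => Finset.Icc 1 L then 1 else 0 := by
  have h1 : (subsetTuples m L).filter (fun U => ∀ i, X i ⊆ U i) =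
      Finset.Icc X fun _ => Finset.Icc 1 L := by
    ext U
    simp only [Finset.mem_filter, mem_subsetTuples, Finset.mem_Icc, Pi.le_def]
    exact and_comm
  rw [mem_subsetTuples] at hX
  rw [mem_properSubsetTuples] at hX'
  push Not at hX'
  obtain ⟨j, hj⟩ := hX'
  have hone : ∀ U ∈ Finset.Icc X fun _ => Finset.Icc 1 L, imageCount m L U = 1 := by
    intro U hU
    rw [Finset.mem_Icc] at hU
    rw [imageCount_eq_fixedPointFormula (mem_subsetTuples.2 hU.2), fixedPointFormula, if_neg]
    exact fun h => hj (Finset.ssubset_of_subset_of_ssubset (hU.1 j) (h.1 j))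
  rw [multiplicity, h1, Finset.sum_congr rfl fun U hU => by
    rw [hone U hU, Nat.cast_one, mul_one, neg_one_pow_sum_sub (Finset.mem_Icc.1 hU).1],
    ← piFinset_Icc, ← Finset.prod_univ_sum (fun i => Finset.Icc (X i) (Finset.Icc 1 L))
      (fun i V => (-1 : ℤ) ^ (V.card - (X i).card)),
    Finset.prod_congr rfl fun i _ => sum_Icc_neg_one_pow (hX i)]
  exact prod_ite_eq (V := fun _ => Finset.Icc 1 L)

end Moebius

/-! ### The spectrum of the transition matrix -/

section Spectrum

variable {m L : ℕ}

/-- The eigenvalue attached to a tuple of subsets. -/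
def weight (x : Fin m → ℕ → ℝ) (X : Fin m → Finset ℕ) : ℝ := ∑ i, ∑ s ∈ X i, x i s

/-- The matrix of a product of operators. -/
def runMatrix (L : ℕ) (W : List (Fin m × ℕ)) : Matrix (Word m L) (Word m L) ℝ :=
  Matrix.of fun w v => if runWord L W v = w then 1 else 0

theorem runMatrix_append (V W : List (Fin m × ℕ)) :
    runMatrix L (V ++ W) = runMatrix L V * runMatrix L W := by
  ext w v
  simp [runMatrix, Matrix.mul_apply, runWord_append]

theorem runMatrix_nil : runMatrix L ([] : List (Fin m × ℕ)) = 1 := by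
  ext w v
  rw [Matrix.one_apply]
  exact if_congr eq_comm rfl rfl

theorem transitionMatrix_eq_sum (x : Fin m → ℕ → ℝ) :
    transitionMatrix m L x = ∑ b, ∑ j ∈ Finset.Icc 1 L, x b j • runMatrix L [(b, j)] := by
  ext w v
  simp only [transitionMatrix, Matrix.of_apply, Matrix.sum_apply, Matrix.smul_apply, runMatrix,
    smul_eq_mul, mul_ite, mul_one, mul_zero]
  rfl

theorem trace_runMatrix (W : List (Fin m × ℕ)) (hW : ∀ s ∈ W, 1 ≤ s.2) :
    (runMatrix L W).trace = imageCount m L (support W) := by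
  rw [← card_fixed_runWord W hW, Matrix.trace, Finset.card_filter]
  simp [runMatrix]

theorem support_append_singleton_subset_iff {W : List (Fin m × ℕ)} {b : Fin m} {j : ℕ}
    {X : Fin m → Finset ℕ} :
    (∀ i, support (W ++ [(b, j)]) i ⊆ X i) ↔ (∀ i, support W i ⊆ X i) ∧ j ∈ X b := by
  simp only [Finset.subset_iff, mem_support, List.mem_append, List.mem_singleton, Prod.mk.injEq]
  constructor
  · exact fun h => ⟨fun i s hs => h i (Or.inl hs), h b (Or.inr ⟨rfl, rfl⟩)⟩
  · rintro ⟨h1, h2⟩ i s (hs | ⟨rfl, rfl⟩)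
    · exact h1 i hs
    · exact h2

/-- The prefix `W` makes the induction work: expanding one factor of the power appends some `(b, j)`
to `W`, which restricts the sum to `X` with `j ∈ X b`. Adding up the `x b j` over these pairs yields
one more factor `weight x X`. -/
theorem trace_runMatrix_mul_pow (x : Fin m → ℕ → ℝ) (k : ℕ) (W : List (Fin m × ℕ))
    (hW : ∀ s ∈ W, s.2 ∈ Finset.Icc 1 L) :
    (runMatrix L W * transitionMatrix m L x ^ k).trace =
      ∑ X ∈ subsetTuples m L with ∀ i, support W i ⊆ X i,
        (multiplicity m L X : ℝ) * weight x X ^ k := by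
  induction k generalizing W with
  | zero =>
    have hS : support W ∈ subsetTuples m L :=
      mem_subsetTuples.2 fun i j hj => hW _ (mem_support.1 hj)
    rw [pow_zero, mul_one, trace_runMatrix W fun s hs => (Finset.mem_Icc.1 (hW s hs)).1]
    have := congrArg (Int.cast (R := ℝ)) (sum_multiplicity hS)
    push_cast at this
    simp [this]
  | succ k ih =>
    have h1 : runMatrix L W * transitionMatrix m L x ^ (k + 1) =
        ∑ b, ∑ j ∈ Finset.Icc 1 L,
          x b j • (runMatrix L (W ++ [(b, j)]) * transitionMatrix m L x ^ k) := by
      rw [pow_succ', ← mul_assoc]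
      conv_lhs => rw [transitionMatrix_eq_sum, Finset.mul_sum, Finset.sum_mul]
      refine Finset.sum_congr rfl fun b _ => ?_
      rw [Finset.mul_sum, Finset.sum_mul]
      refine Finset.sum_congr rfl fun j _ => ?_
      rw [runMatrix_append, Matrix.mul_smul, Matrix.smul_mul, ← transitionMatrix_eq_sum]
    have h2 : ∀ b, ∀ j ∈ Finset.Icc 1 L,
        (x b j • (runMatrix L (W ++ [(b, j)]) * transitionMatrix m L x ^ k)).trace =
          ∑ X ∈ subsetTuples m L with ∀ i, support W i ⊆ X i,
            if j ∈ X b then x b j * ((multiplicity m L X : ℝ) * weight x X ^ k) else 0 := by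
      intro b j hj
      rw [Matrix.trace_smul, ih (W ++ [(b, j)]) (by
        intro s hs
        rcases List.mem_append.1 hs with hs | hs
        · exact hW s hs
        · rw [List.mem_singleton.1 hs]
          exact hj), smul_eq_mul, Finset.mul_sum, ← Finset.sum_filter, Finset.filter_filter]
      simp only [support_append_singleton_subset_iff]
    rw [h1, Matrix.trace_sum]
    simp only [Matrix.trace_sum]
    rw [Finset.sum_congr rfl fun b _ => (Finset.sum_congr rfl (h2 b)).trans Finset.sum_comm,
      Finset.sum_comm]
    refine Finset.sum_congr rfl fun X hX => ?_
    have hX' := mem_subsetTuples.1 (Finset.mem_filter.1 hX).1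
    have h3 : weight x X = ∑ b, ∑ j ∈ Finset.Icc 1 L, if j ∈ X b then x b j else 0 := by
      refine Finset.sum_congr rfl fun b _ => ?_
      rw [← Finset.sum_filter, Finset.filter_mem_eq_inter,
        Finset.inter_eq_right.2 (hX' b)]
    rw [pow_succ']
    conv_rhs => rw [mul_left_comm, h3, Finset.sum_mul]
    refine Finset.sum_congr rfl fun b _ => ?_
    rw [Finset.sum_mul]
    refine Finset.sum_congr rfl fun j _ => ?_
    rw [ite_mul, zero_mul, ← h3]

theorem count_roots_charpoly_transitionMatrix (x : Fin m → ℕ → ℝ) (μ : ℂ) :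
    ((((transitionMatrix m L x).map Complex.ofRealHom).charpoly.roots.count μ : ℕ) : ℤ) =
      ∑ X ∈ subsetTuples m L with ((weight x X : ℝ) : ℂ) = μ, multiplicity m L X := by
  have := count_roots_charpoly_of_trace_pow (subsetTuples m L)
    ((transitionMatrix m L x).map Complex.ofRealHom) (fun X => (multiplicity m L X : ℂ))
    (fun X => ((weight x X : ℝ) : ℂ)) (fun k => by
      have h1 := trace_runMatrix_mul_pow (L := L) x k [] (by simp)
      rw [runMatrix_nil, one_mul] at h1
      have h2 : ((transitionMatrix m L x).map Complex.ofRealHom ^ k).trace =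
          Complex.ofRealHom (transitionMatrix m L x ^ k).trace := by
        rw [AddMonoidHom.map_trace, Matrix.map_pow]
      rw [h2, h1]
      simp [support]) μ
  exact_mod_cast this

theorem exists_weight_injective : ∃ x : Fin m → ℕ → ℝ, Function.Injective (weight x) := by
  -- Distinct powers of 2 for distinct pairs, so a tuple is recovered from the binary digits of its
  -- weight.
  refine ⟨fun b j => 2 ^ Nat.pair b j, fun X Y h => ?_⟩
  have key : ∀ X : Fin m → Finset ℕ, weight (fun b j => 2 ^ Nat.pair b j) X =
      ((∑ n ∈ (Finset.univ.sigma X).image fun p => Nat.pair p.1 p.2, 2 ^ n : ℕ) : ℝ) := by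
    intro X
    rw [Finset.sum_image]
    · rw [Finset.sum_sigma]
      simp [weight]
    · rintro ⟨a, i⟩ _ ⟨b, j⟩ _ h
      obtain ⟨h1, h2⟩ := Nat.pair_eq_pair.1 h
      simp only at h1 h2
      rw [Fin.ext h1, h2]
  rw [key, key, Nat.cast_inj] at h
  have h1 := Finset.geomSum_injective le_rfl h
  have h2 : ∀ X : Fin m → Finset ℕ, ∀ b j, j ∈ X b ↔
      Nat.pair b j ∈ (Finset.univ.sigma X).image fun p => Nat.pair p.1 p.2 := by
    intro X b j
    simp only [Finset.mem_image, Finset.mem_sigma, Finset.mem_univ, true_and, Sigma.exists,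
      Nat.pair_eq_pair]
    constructor
    · exact fun h => ⟨b, j, h, rfl, rfl⟩
    · rintro ⟨a, i, h, h1, rfl⟩
      rwa [← Fin.ext h1]
  funext b
  ext j
  rw [h2 X, h1, ← h2 Y]

/-- For weights separating all tuples, `multiplicity m L X` is the algebraic multiplicity of a
single eigenvalue, and it does not depend on `x`. -/
theorem multiplicity_nonneg {X : Fin m → Finset ℕ} (hX : X ∈ subsetTuples m L) :
    0 ≤ multiplicity m L X := by
  obtain ⟨x, hx⟩ := exists_weight_injective (m := m)
  have h := count_roots_charpoly_transitionMatrix (L := L) x (weight x X)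
  have h1 : (subsetTuples m L).filter (fun Y => ((weight x Y : ℝ) : ℂ) = weight x X) = {X} := by
    ext Y
    simp only [Finset.mem_filter, Finset.mem_singleton, Complex.ofReal_inj, hx.eq_iff]
    exact ⟨fun h => h.2, fun h => ⟨h ▸ hX, h⟩⟩
  rw [h1, Finset.sum_singleton] at h
  rw [← h]
  exact Int.natCast_nonneg _

open Polynomial in
theorem charpoly_transitionMatrix_eq_prod (x : Fin m → ℕ → ℝ) :
    (transitionMatrix m L x).charpoly =
      ∏ I ∈ subsetTuples m L, (X - C (weight x I)) ^ (multiplicity m L I).toNat := by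
  -- Over `ℂ` the polynomial is known to split, so comparing roots with multiplicity is enough.
  apply Polynomial.map_injective Complex.ofRealHom Complex.ofReal_injective
  have hroots : ((transitionMatrix m L x).map Complex.ofRealHom).charpoly.roots =
      ∑ I ∈ subsetTuples m L,
        Multiset.replicate (multiplicity m L I).toNat ((weight x I : ℝ) : ℂ) := by
    ext μ
    rw [← Nat.cast_inj (R := ℤ), count_roots_charpoly_transitionMatrix, Multiset.count_sum',
      Finset.sum_filter, Nat.cast_sum]
    refine Finset.sum_congr rfl fun I hI => ?_
    rw [Multiset.count_replicate]
    split_ifs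
    · rw [Int.toNat_of_nonneg (multiplicity_nonneg hI)]
    · rfl
  rw [← Matrix.charpoly_map,
    (IsAlgClosed.splits _).eq_prod_roots_of_monic (Matrix.charpoly_monic _), hroots,
    ← Multiset.coe_mapAddMonoidHom, map_sum, Multiset.prod_sum, Polynomial.map_prod]
  refine Finset.prod_congr rfl fun I _ => ?_
  simp

end Spectrum

end ToomTsetlin

theorem mainTheorem8 (m L : ℕ) (hm : 0 < m) (x : Fin m → ℕ → ℝ) :
    (ToomTsetlin.transitionMatrix m L x).charpoly =
        (Polynomial.X - Polynomial.C (∑ i : Fin m, ∑ s ∈ Finset.Icc 1 L, x i s)) *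
          ∏ I ∈ ToomTsetlin.properSubsetTuples m L,
            (Polynomial.X - Polynomial.C (∑ i : Fin m, ∑ s ∈ I i, x i s)) ^
              (ToomTsetlin.multiplicity m L I).toNat ∧
      (∀ I ∈ ToomTsetlin.properSubsetTuples m L, 0 ≤ ToomTsetlin.multiplicity m L I) ∧
      (∀ U ∈ ToomTsetlin.subsetTuples m L,
        (∀ w, ToomTsetlin.tupleMap m L U (ToomTsetlin.tupleMap m L U w) =
          ToomTsetlin.tupleMap m L U w) ∧
        ToomTsetlin.imageCount m L U = ToomTsetlin.fixedPointFormula m L U) := by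
  open ToomTsetlin in
  have hsub : properSubsetTuples m L ⊆ subsetTuples m L := fun I hI =>
    mem_subsetTuples.2 fun i => (mem_properSubsetTuples.1 hI i).subset
  refine ⟨?_, fun I hI => multiplicity_nonneg (hsub hI), fun U hU =>
    ⟨tupleMap_tupleMap fun b h => by simpa using mem_subsetTuples.1 hU b h,
      imageCount_eq_fixedPointFormula hU⟩⟩
  rw [charpoly_transitionMatrix_eq_prod]
  have hfull : (fun _ => Finset.Icc 1 L) ∈ subsetTuples m L :=
    mem_subsetTuples.2 fun _ => subset_rfl
  -- A letter is needed here: for `m = 0` the only tuple is vacuously proper and its factor would be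
  -- counted twice.
  have hfull' : (fun _ => Finset.Icc 1 L) ∉ properSubsetTuples m L := fun h =>
    (mem_properSubsetTuples.1 h ⟨0, hm⟩).ne rfl
  have hins : insert (fun _ => Finset.Icc 1 L) (properSubsetTuples m L) ⊆ subsetTuples m L :=
    Finset.insert_subset hfull hsub
  rw [← Finset.prod_subset hins, Finset.prod_insert hfull',
    multiplicity_of_notMem hfull hfull', if_pos rfl]
  · simp [weight]
  · intro I hI hI'
    rw [Finset.mem_insert, not_or] at hI'
    rw [multiplicity_of_notMem hI hI'.2, if_neg hI'.1]
    simp
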